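/- Let $\nu\ge 1$, $\beta>0$, $\lambda>0$, $\Delta>0$ and $\mu\in\mathbb R$. For $L>0$ let $\Lambda=[-L/2,L/2]^\nu$ with periodic boundary conditions, $V=L^\nu$, $\Lambda^*=(2\pi/L)\mathbb Z^\nu$, and let $a_k^\dagger,a_k$ ($k\in\Lambda^*$) be the Bose creation and annihilation operators of the plane-wave modes on the boson Fock space, $N_k=a_k^\dagger a_k$, $N_\Lambda=\sum_{k\in\Lambda^*}N_k$. For $\Delta'\ge 0$, $\lambda'\ge 0$ let $$H^{\Delta'}_{\Lambda,\lambda'}=\sum_{k\in\Lambda^*}|k|^2a_k^\dagger a_k-\Delta' a_0^\dagger a_0+\frac{\lambda'}{2V}N_\Lambda^2 ,$$ and let $\langle\,\cdot\,\rangle_{H}(\beta,\mu')$ be the grand-canonical Gibbs expectation $\langle B\rangle=\operatorname{Tr}(e^{-\beta(H-\mu' N_\Lambda)}B)/\operatorname{Tr}e^{-\beta(H-\mu' N_\Lambda)}$. All expectations below exist in every box. Let $$\rho^P(\beta,-\Delta)=\frac1{(2\pi)^\nu}\int_{\mathbb R^\nu}\frac{dk}{e^{\beta(|k|^2+\Delta)}-1}$$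 be the density of the perfect Bose gas at chemical potential $-\Delta$; it is finite and equals $\lim_{L\to\infty}\frac1V\langle N_\Lambda\rangle_{H^{0}_{\Lambda,0}}(\beta,-\Delta)$. Then the limiting density of the gapless mean-field gas, $\rho^{(\Delta=0)}_\lambda(\beta,\mu)=\lim_{L\to\infty}\frac1V\langle N_\Lambda\rangle_{H^{0}_{\Lambda,\lambda}}(\beta,\mu)$, exists, and for the mean-field Bose gas with gap $\Delta$ the following limits exist and are given by $$\lim_{L\to\infty}\frac1V\langle N_\Lambda\rangle_{H^{\Delta}_{\Lambda,\lambda}}(\beta,\mu)=\begin{cases}\rho^{(\Delta=0)}_\lambda(\beta,\mu),&\mu\le-\Delta+\lambda\rho^P(\beta,-\Delta),\\(\mu+\Delta)/\lambda,&\mu>-\Delta+\lambda\rho^P(\beta,-\Delta),\end{cases}$$ $$\lim_{L\to\infty}\frac1V\langle N_0\rangle_{H^{\Delta}_{\Lambda,\lambda}}(\beta,\mu)=\begin{cases}0,&\mu\le-\Delta+\lambda\rho^P(\beta,-\Delta),\\(\mu+\Delta)/\lambda-\rho^P(\beta,-\Delta),&\mu>-\Delta+\lambda\rho^P(\beta,-\Delta),\end{cases}$$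 $$\lim_{L\to\infty}\frac1{V^2}\langle N_\Lambda^2\rangle_{H^{\Delta}_{\Lambda,\lambda}}(\beta,\mu)=\begin{cases}\rho^{(\Delta=0)}_\lambda(\beta,\mu)^2,&\mu\le-\Delta+\lambda\rho^P(\beta,-\Delta),\\(\mu+\Delta)^2/\lambda^2,&\mu>-\Delta+\lambda\rho^P(\beta,-\Delta).\end{cases}$$ -/

import Mathlib

open Filter Topology

noncomputable section

namespace BoseGas

/-- Labels of the momentum modes: `m` stands for the vector `k = 2π m / L` of the dual lattice
of the periodic box `[-L/2, L/2]^ν`. -/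
abbrev Mode (ν : ℕ) : Type := Fin ν → ℤ

/-- Occupation numbers: finitely many particles distributed over the modes. -/
abbrev Occ (ν : ℕ) : Type := Mode ν →₀ ℕ

/-- The boson Fock space over the one-particle space spanned by the plane waves of the box, in the
occupation number representation: the Hilbert space `ℓ²` over all occupation numbers. -/
abbrev Fock (ν : ℕ) : Type := lp (fun _ : Occ ν => ℂ) 2

/-- The common dense domain of all operators below: finite linear combinations of occupation
number states. -/
abbrev Core (ν : ℕ) : Type := Occ ν →₀ ℂ

/-- The occupation number state `|n⟩`. -/
def ket {ν : ℕ} (n : Occ ν) : Core ν := Finsupp.single n 1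

/-- The inclusion of the dense domain into the Fock space; it sends the states `|n⟩` to the
standard orthonormal basis. -/
def toFock (ν : ℕ) : Core ν →ₗ[ℂ] Fock ν :=
  Finsupp.linearCombination ℂ (fun n : Occ ν => lp.single 2 n (1 : ℂ))

/-- The annihilation operator `a_k`: `a_k |n⟩ = √(n_k) |n - e_k⟩`. -/
def annihilation {ν : ℕ} (k : Mode ν) : Module.End ℂ (Core ν) :=
  Finsupp.linearCombination ℂ
    (fun n : Occ ν => ((√(n k : ℝ) : ℝ) : ℂ) • ket (n - Finsupp.single k 1))

/-- The creation operator `a†_k`: `a†_k |n⟩ = √(n_k + 1) |n + e_k⟩`. -/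
def creation {ν : ℕ} (k : Mode ν) : Module.End ℂ (Core ν) :=
  Finsupp.linearCombination ℂ
    (fun n : Occ ν => ((√((n k : ℝ) + 1) : ℝ) : ℂ) • ket (n + Finsupp.single k 1))

/-- The occupation number operator `N_k = a†_k a_k`. -/
def modeNumber {ν : ℕ} (k : Mode ν) : Module.End ℂ (Core ν) := creation k * annihilation k

/-- The operator `∑_k c_k a†_k a_k`; on each `|n⟩` only finitely many terms are nonzero. -/
def modeSum {ν : ℕ} (c : Mode ν → ℝ) : Module.End ℂ (Core ν) :=
  Finsupp.linearCombination ℂ (fun n : Occ ν => ∑ᶠ k : Mode ν, (c k : ℂ) • modeNumber k (ket n))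

/-- The total number operator `N_Λ = ∑_k N_k`. -/
def totalNumber (ν : ℕ) : Module.End ℂ (Core ν) := modeSum (fun _ => 1)

/-- The one-particle energy `ε_k = |k|²` at `k = 2π m / L`, in units `ħ²/2m = 1`. -/
def modeEnergy {ν : ℕ} (L : ℝ) (m : Mode ν) : ℝ := ∑ i, (2 * Real.pi * (m i : ℝ) / L) ^ 2

/-- The kinetic energy with gap, `T = ∑_k ε_k a†_k a_k - Δ a†_0 a_0`. -/
def kinetic (ν : ℕ) (L Δ : ℝ) : Module.End ℂ (Core ν) :=
  modeSum (modeEnergy L) - (Δ : ℂ) • modeNumber 0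

/-- The mean-field Hamiltonian `H = T + (lam / 2V) N_Λ²` in the box of volume `V = L^ν`. -/
def meanFieldHamiltonian (ν : ℕ) (L Δ lam : ℝ) : Module.End ℂ (Core ν) :=
  kinetic ν L Δ + ((lam / (2 * L ^ ν) : ℝ) : ℂ) • totalNumber ν ^ 2

/-- The operator exponential `e^A ψ = ∑_j A^j ψ / j!` on vectors of the dense domain (used below
for operators all of whose domain vectors are analytic vectors, being finite combinations of
eigenvectors). The sum is taken in the Fock space. -/
def expOp {ν : ℕ} (A : Module.End ℂ (Core ν)) (ψ : Core ν) : Fock ν :=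
  ∑' j : ℕ, ((j.factorial : ℂ)⁻¹) • toFock ν ((A ^ j) ψ)

/-- The diagonal matrix element `⟨n| e^{-β(H - μ N_Λ)} B |n⟩` for the mean-field Hamiltonian. -/
def gibbsDiag (ν : ℕ) (L Δ lam β μ : ℝ) (B : Module.End ℂ (Core ν)) (n : Occ ν) : ℂ :=
  inner ℂ (toFock ν (ket n))
    (expOp ((-β : ℂ) • (meanFieldHamiltonian ν L Δ lam - (μ : ℂ) • totalNumber ν)) (B (ket n)))

/-- The sums over the orthonormal basis that define `Tr e^{-β(H - μ N_Λ)}` and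
`Tr (e^{-β(H - μ N_Λ)} B)` converge absolutely, and the partition function is not zero. -/
def GibbsDefined (ν : ℕ) (L Δ lam β μ : ℝ) (B : Module.End ℂ (Core ν)) : Prop :=
  Summable (gibbsDiag ν L Δ lam β μ 1) ∧ (∑' n, gibbsDiag ν L Δ lam β μ 1 n) ≠ 0 ∧
    Summable (gibbsDiag ν L Δ lam β μ B)

/-- The grand-canonical expectation
`⟨B⟩ = Tr (e^{-β(H - μ N_Λ)} B) / Tr e^{-β(H - μ N_Λ)}`. -/
def gibbsMean (ν : ℕ) (L Δ lam β μ : ℝ) (B : Module.End ℂ (Core ν)) : ℂ :=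
  (∑' n, gibbsDiag ν L Δ lam β μ B n) / (∑' n, gibbsDiag ν L Δ lam β μ 1 n)

/-- The density of the perfect Bose gas,
`ρ^P(β, μ) = (2π)^{-ν} ∫ dk / (e^{β(|k|² - μ)} - 1)`, for `μ < 0`. -/
def perfectDensity (ν : ℕ) (β μ : ℝ) : ℝ :=
  ((2 * Real.pi) ^ ν)⁻¹ *
    ∫ k : EuclideanSpace ℝ (Fin ν), (Real.exp (β * (‖k‖ ^ 2 - μ)) - 1)⁻¹

end BoseGas

end

/-!
In the occupation number basis all operators are diagonal, so every Gibbs expectation is a mean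
over `n : Mode ν →₀ ℕ` with the weight `exp (-∑ k, n k * e k - κ N²)`, where
`e k = β (|k|² - Δ δ_{k,0} - μ)` and `κ = β lam / 2V`.

The thermodynamic limit is extracted from a single inequality, `BoseGas.mean_field_le`: a Gibbs
state minimises its free energy. The mean-field state is compared with a perfect gas, with
chemical potential `a < 0` in the modes `k ≠ 0` and energy `t > 0` in the zero mode, to which
`M` particles in the zero mode have been added. Jensen's inequality is used once for each of the
two states and both partition functions cancel, so pressures never have to be computed. The moments
of the perfect gas come from the reindexing `n ↦ n + e_k` (`BoseGas.tsum_occupation_mul`); its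
variance is of the order of the volume, and its density is a Riemann sum for `perfectDensity`
(`BoseGas.tendsto_tsum_bose`). Per volume, with `M / V → m`, the inequality becomes
(`BoseGas.eventually_variational_le`), up to an arbitrarily small error,
`(lam/2) ⟨N²⟩/V² + (a - μ) ⟨N⟩/V - (Δ + t + a) ⟨N_0⟩/V`
`  ≤ (lam/2) (ρ(a) + m)² + (a - μ) ρ(a) - m (Δ + μ)`,
where `ρ(a)` is the density of the perfect gas.

What remains is calculus (`BoseGas.IsVariational`). For `t = -Δ - a` the zero-mode term drops out
and the left side is, up to an additive constant, `lam/2` times the mean square deviation of `N/V`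
from `(μ - a)/lam`.
* If `lam ρ(a) = μ - a` for some `a < -Δ`, then `m = 0` shows that `N/V` concentrates at `ρ(a)`,
  and a smaller `t` that the zero mode is not macroscopically occupied.
* If `lam ρ(a) ≤ μ - a` for all `a < -Δ`, then `m = (μ - a)/lam - ρ(a)` and `a → -Δ` show that
  `N/V` concentrates at `(μ + Δ)/lam`. For `Δ > 0`, letting `a` approach `-Δ` from both sides with
  `t → 0` shows that the modes `k ≠ 0` have the density `ρ(-Δ)`.

By monotonicity and continuity of `ρ`, the threshold `μ = -Δ + lam ρ(-Δ)` separates the two cases.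
The same dichotomy with `Δ = 0` gives the gapless gas; below the threshold both gases have the
same root `a`, and at the threshold `a = -Δ`.
-/

noncomputable section

namespace BoseGas

/-! ### Occupation numbers and free Bose gases -/

section FreeGas

variable {ι : Type*}

/-- The value `∑ k, n k * e k` of the additive observable with one-particle values `e` at the
occupation numbers `n`. -/
def additive (e : ι → ℝ) (n : ι →₀ ℕ) : ℝ := Finsupp.linearCombination ℕ e n

/-- The particle number `∑ k, n k`, as a real number. -/
def particles (n : ι →₀ ℕ) : ℝ := additive (fun _ => 1) n

lemma additive_eq_sum (e : ι → ℝ) (n : ι →₀ ℕ) {S : Finset ι} (hS : n.support ⊆ S) :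
    additive e n = ∑ k ∈ S, (n k : ℝ) * e k := by
  rw [additive, Finsupp.linearCombination_apply, Finsupp.sum_of_support_subset _ hS]
  · simp
  · simp

lemma additive_add (e : ι → ℝ) (n m : ι →₀ ℕ) :
    additive e (n + m) = additive e n + additive e m := by simp [additive]

lemma additive_single (e : ι → ℝ) (k : ι) (j : ℕ) :
    additive e (Finsupp.single k j) = j * e k := by simp [additive]

lemma additive_add_left (e f : ι → ℝ) (n : ι →₀ ℕ) :
    additive (fun k => e k + f k) n = additive e n + additive f n := by
  simp [additive_eq_sum _ n subset_rfl, mul_add, Finset.sum_add_distrib]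

lemma additive_const_mul (c : ℝ) (e : ι → ℝ) (n : ι →₀ ℕ) :
    additive (fun k => c * e k) n = c * additive e n := by
  simp only [additive_eq_sum _ n subset_rfl, Finset.mul_sum]
  exact Finset.sum_congr rfl fun k _ => by ring

lemma additive_sub_left (e f : ι → ℝ) (n : ι →₀ ℕ) :
    additive (fun k => e k - f k) n = additive e n - additive f n := by
  simp [additive_eq_sum _ n subset_rfl, mul_sub, Finset.sum_sub_distrib]

lemma additive_mono {e f : ι → ℝ} (h : ∀ k, e k ≤ f k) (n : ι →₀ ℕ) :
    additive e n ≤ additive f n := by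
  rw [additive_eq_sum _ n subset_rfl, additive_eq_sum _ n subset_rfl]
  exact Finset.sum_le_sum fun k _ => mul_le_mul_of_nonneg_left (h k) (Nat.cast_nonneg _)

lemma additive_const (c : ℝ) (n : ι →₀ ℕ) : additive (fun _ => c) n = c * particles n := by
  rw [particles, ← additive_const_mul]; simp

lemma additive_ite [DecidableEq ι] (k₀ : ι) (a b : ℝ) (n : ι →₀ ℕ) :
    additive (fun k => if k = k₀ then a else b) n = b * particles n + (a - b) * n k₀ := by
  have h1 : additive (fun k => if k = k₀ then (1 : ℝ) else 0) n = n k₀ := by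
    rw [additive_eq_sum _ n (Finset.subset_insert k₀ n.support)]
    simp
  have h2 : (fun k => if k = k₀ then a else b) =
      fun k => b + (a - b) * (if k = k₀ then (1 : ℝ) else 0) := by
    funext k; split_ifs <;> ring
  rw [h2, additive_add_left, additive_const_mul, additive_const, h1]

lemma particles_nonneg (n : ι →₀ ℕ) : 0 ≤ particles n := by
  rw [particles, additive_eq_sum _ n subset_rfl]; positivity

lemma particles_add_single (n : ι →₀ ℕ) (k : ι) (j : ℕ) :
    particles (n + Finsupp.single k j) = particles n + j := by
  simp [particles, additive_add, additive_single]

lemma le_particles (n : ι →₀ ℕ) (k : ι) : (n k : ℝ) ≤ particles n := by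
  classical
  rw [particles, additive_eq_sum _ n (Finset.subset_insert k n.support)]
  calc (n k : ℝ) = n k * 1 := by ring
    _ ≤ _ := Finset.single_le_sum (f := fun k => (n k : ℝ) * 1) (fun _ _ => by positivity)
      (Finset.mem_insert_self k _)

lemma abs_additive_le {d : ι → ℝ} {D : ℝ} (h : ∀ k, |d k| ≤ D) (n : ι →₀ ℕ) :
    |additive d n| ≤ D * particles n := by
  rw [abs_le, ← additive_const, neg_eq_neg_one_mul, ← additive_const_mul]
  exact ⟨additive_mono (fun k => by linarith [(abs_le.1 (h k)).1]) n,
    additive_mono (fun k => (abs_le.1 (h k)).2) n⟩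

/-- The unnormalised Gibbs weight `exp (-∑ k, n k * η k)` of a free gas whose mode `k` has
reduced energy `η k = β (ε k - μ)`. -/
def boltzmann (η : ι → ℝ) (n : ι →₀ ℕ) : ℝ := Real.exp (-additive η n)

/-- The Bose–Einstein mean occupation number of a mode of reduced energy `x`. -/
def bose (x : ℝ) : ℝ := (Real.exp x - 1)⁻¹

/-- The reduced energies `η` describe a free Bose gas with a trace-class Gibbs weight: they are
bounded away from zero and the Bose–Einstein occupation numbers have a finite sum. -/
structure IsFreeGas (η : ι → ℝ) : Prop where
  gap : ∃ s > 0, ∀ k, s ≤ η k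
  summable_bose : Summable fun k => bose (η k)

lemma exp_sub_one_pos {x : ℝ} (hx : 0 < x) : 0 < Real.exp x - 1 := by
  linarith [Real.add_one_lt_exp hx.ne']

lemma bose_pos {x : ℝ} (hx : 0 < x) : 0 < bose x := inv_pos.2 (exp_sub_one_pos hx)

lemma IsFreeGas.pos {η : ι → ℝ} (h : IsFreeGas η) (k : ι) : 0 < η k := by
  obtain ⟨s, hs, hk⟩ := h.gap
  exact hs.trans_le (hk k)

/-- Lowering all energies by a small constant keeps the gas admissible. The weights then gain a
factor `exp (s N)`, which dominates every power of the particle number. -/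
lemma IsFreeGas.exists_sub {η : ι → ℝ} (h : IsFreeGas η) :
    ∃ s > 0, IsFreeGas fun k => η k - s := by
  obtain ⟨s, hs, hk⟩ := h.gap
  refine ⟨s / 2, by positivity, ⟨s / 2, by positivity, fun k => by linarith [hk k]⟩, ?_⟩
  refine Summable.of_nonneg_of_le (fun k => (bose_pos (by linarith [hk k])).le) (fun k => ?_)
    (h.summable_bose.mul_left (2 * Real.exp (s / 2)))
  have h1 : 1 < Real.exp (s / 2) := Real.one_lt_exp_iff.2 (by positivity)
  have h2 : Real.exp (s / 2) * Real.exp (s / 2) ≤ Real.exp (η k) := by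
    rw [← Real.exp_add]; exact Real.exp_le_exp.2 (by linarith [hk k])
  have h3 : 0 < Real.exp (η k) - 1 := exp_sub_one_pos (h.pos k)
  have h4 : 0 < Real.exp (η k - s / 2) - 1 := exp_sub_one_pos (by linarith [hk k])
  have h5 : Real.exp (η k) = Real.exp (s / 2) * Real.exp (η k - s / 2) := by
    rw [← Real.exp_add]; ring_nf
  unfold bose
  rw [← div_eq_mul_inv, inv_eq_one_div, div_le_div_iff₀ h4 h3, h5]
  rw [h5] at h2
  have h6 : Real.exp (s / 2) ≤ Real.exp (η k - s / 2) :=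
    le_of_mul_le_mul_left h2 (by positivity)
  nlinarith

lemma boltzmann_pos (η : ι → ℝ) (n : ι →₀ ℕ) : 0 < boltzmann η n := Real.exp_pos _

/-- The finite partial sums of the partition function are bounded by the finite products
`∏ k, (1 - exp (-η k))⁻¹ = ∏ k, (1 + bose (η k)) ≤ exp (∑ k, bose (η k))`. -/
lemma IsFreeGas.summable_boltzmann {η : ι → ℝ} (h : IsFreeGas η) :
    Summable (boltzmann η) := by
  classical
  refine summable_of_sum_le (c := Real.exp (∑' k, bose (η k)))
    (fun n => (boltzmann_pos η n).le) fun T => ?_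
  set S : Finset ι := T.biUnion fun n => n.support
  have hS : ∀ n ∈ T, n.support ⊆ S := fun n hn => Finset.subset_biUnion_of_mem _ hn
  set t : S → Finset ℕ := fun k => T.image fun n => n k
  have hw : ∀ n ∈ T, boltzmann η n = ∏ k : S, Real.exp (-η k) ^ (n k) := by
    intro n hn
    rw [boltzmann, additive_eq_sum η n (hS n hn), Finset.prod_coe_sort S
      (fun k => Real.exp (-η k) ^ (n k)), ← Finset.sum_neg_distrib, Real.exp_sum]
    refine Finset.prod_congr rfl fun k _ => ?_
    rw [← Real.exp_nat_mul]; ring_nf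
  have hinj : Set.InjOn (fun (n : ι →₀ ℕ) (k : S) => n k) T := by
    intro n hn m hm hnm
    ext k
    by_cases hk : k ∈ S
    · exact congrFun hnm ⟨k, hk⟩
    · rw [Finsupp.notMem_support_iff.1 fun h => hk (hS n hn h),
        Finsupp.notMem_support_iff.1 fun h => hk (hS m hm h)]
  calc ∑ n ∈ T, boltzmann η n
      = ∑ x ∈ T.image (fun (n : ι →₀ ℕ) (k : S) => n k),
          ∏ k : S, Real.exp (-η k) ^ (x k) := by
        rw [Finset.sum_image hinj]; exact Finset.sum_congr rfl hw
    _ ≤ ∑ x ∈ Fintype.piFinset t, ∏ k : S, Real.exp (-η k) ^ (x k) := by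
        refine Finset.sum_le_sum_of_subset_of_nonneg ?_ fun _ _ _ => by positivity
        intro x hx
        obtain ⟨n, hn, rfl⟩ := Finset.mem_image.1 hx
        exact Fintype.mem_piFinset.2 fun k => Finset.mem_image_of_mem _ hn
    _ = ∏ k : S, ∑ j ∈ t k, Real.exp (-η k) ^ j := (Finset.prod_univ_sum t _).symm
    _ ≤ ∏ k : S, Real.exp (bose (η k)) := by
        refine Finset.prod_le_prod (fun _ _ => by positivity) fun k _ => ?_
        have hlt : Real.exp (-η k) < 1 := Real.exp_lt_one_iff.2 (by linarith [h.pos (k : ι)])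
        have hsum := summable_geometric_of_lt_one (Real.exp_pos (-η k)).le hlt
        refine (hsum.sum_le_tsum (t k) fun _ _ => by positivity).trans ?_
        rw [tsum_geometric_of_lt_one (Real.exp_pos _).le hlt]
        refine le_trans (le_of_eq ?_) (Real.add_one_le_exp _)
        have h3 := exp_sub_one_pos (h.pos (k : ι))
        rw [bose, Real.exp_neg]
        have h4 := Real.exp_pos (η k)
        have h5 : 1 - (Real.exp (η k))⁻¹ ≠ 0 := by
          rw [← Real.exp_neg]; linarith
        field_simp
        ring
    _ = Real.exp (∑ k ∈ S, bose (η k)) := by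
        rw [Finset.prod_coe_sort S (fun k => Real.exp (bose (η k))), Real.exp_sum]
    _ ≤ _ := Real.exp_le_exp.2
        (h.summable_bose.sum_le_tsum S fun k _ => (bose_pos (h.pos k)).le)

/-- Observables of at most quadratic growth in the particle number have an absolutely convergent
Gibbs sum. -/
lemma IsFreeGas.summable_mul {η : ι → ℝ} (h : IsFreeGas η) {f : (ι →₀ ℕ) → ℝ} {C : ℝ}
    (hf : ∀ n, |f n| ≤ C * (1 + particles n) ^ 2) : Summable fun n => f n * boltzmann η n := by
  obtain ⟨s, hs, hs'⟩ := h.exists_sub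
  have hC : 0 ≤ C := by simpa [particles, additive] using (abs_nonneg _).trans (hf 0)
  refine Summable.of_norm_bounded
    ((hs'.summable_boltzmann).mul_left (C * (2 * Real.exp s / s ^ 2))) fun n => ?_
  have hN := particles_nonneg n
  have h1 := Real.pow_div_factorial_le_exp (s * (1 + particles n)) (by positivity) 2
  have h2 : (1 + particles n) ^ 2 ≤ 2 * Real.exp s / s ^ 2 * Real.exp (s * particles n) := by
    have : Real.exp (s * (1 + particles n)) = Real.exp s * Real.exp (s * particles n) := by
      rw [← Real.exp_add]; ring_nf
    rw [this] at h1
    simp only [Nat.factorial, mul_pow] at h1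
    rw [div_mul_eq_mul_div, le_div_iff₀ (by positivity)]
    norm_num at h1
    linarith
  have h3 : boltzmann (fun k => η k - s) n = Real.exp (s * particles n) * boltzmann η n := by
    rw [boltzmann, boltzmann, additive_sub_left, additive_const, ← Real.exp_add]; ring_nf
  rw [Real.norm_eq_abs, abs_mul, abs_of_pos (boltzmann_pos η n), h3, ← mul_assoc]
  refine mul_le_mul_of_nonneg_right ?_ (boltzmann_pos η n).le
  rw [mul_assoc]
  exact (hf n).trans (mul_le_mul_of_nonneg_left h2 hC)

lemma abs_one_le (n : ι →₀ ℕ) : |(1 : ℝ)| ≤ 1 * (1 + particles n) ^ 2 := by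
  rw [abs_one]; nlinarith [particles_nonneg n]

lemma abs_particles_le (n : ι →₀ ℕ) : |particles n| ≤ 1 * (1 + particles n) ^ 2 := by
  rw [abs_of_nonneg (particles_nonneg n)]; nlinarith [particles_nonneg n]

lemma abs_particles_sq_le (n : ι →₀ ℕ) : |particles n ^ 2| ≤ 1 * (1 + particles n) ^ 2 := by
  rw [abs_of_nonneg (sq_nonneg _)]; nlinarith [particles_nonneg n]

lemma abs_occupation_le (k : ι) (n : ι →₀ ℕ) : |(n k : ℝ)| ≤ 1 * (1 + particles n) ^ 2 := by
  rw [abs_of_nonneg (Nat.cast_nonneg _)]; nlinarith [particles_nonneg n, le_particles n k]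

lemma abs_occupation_mul_particles_le (k : ι) (n : ι →₀ ℕ) :
    |(n k : ℝ) * particles n| ≤ 1 * (1 + particles n) ^ 2 := by
  have := particles_nonneg n
  rw [abs_of_nonneg (by positivity)]; nlinarith [le_particles n k]

lemma abs_additive_le_sq {d : ι → ℝ} {D : ℝ} (h : ∀ k, |d k| ≤ D) (hD : 0 ≤ D) (n : ι →₀ ℕ) :
    |additive d n| ≤ D * (1 + particles n) ^ 2 :=
  (abs_additive_le h n).trans
    (mul_le_mul_of_nonneg_left (by nlinarith [particles_nonneg n]) hD)

/-- The mean of the observable `f` in the state with unnormalised weights `w`. -/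
def mean (w f : (ι →₀ ℕ) → ℝ) : ℝ := (∑' n, f n * w n) / ∑' n, w n

lemma mean_add {w f g : (ι →₀ ℕ) → ℝ} (hf : Summable fun n => f n * w n)
    (hg : Summable fun n => g n * w n) : mean w (fun n => f n + g n) = mean w f + mean w g := by
  simp only [mean, add_mul]
  rw [hf.tsum_add hg, add_div]

lemma mean_const_mul (w f : (ι →₀ ℕ) → ℝ) (c : ℝ) :
    mean w (fun n => c * f n) = c * mean w f := by
  simp only [mean, mul_assoc]
  rw [tsum_mul_left, mul_div_assoc]

lemma mean_one {w : (ι →₀ ℕ) → ℝ} (h : 0 < ∑' n, w n) : mean w (fun _ => 1) = 1 := by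
  simp [mean, h.ne']

lemma mean_mono {w f g : (ι →₀ ℕ) → ℝ} (hw : ∀ n, 0 ≤ w n) (hf : Summable fun n => f n * w n)
    (hg : Summable fun n => g n * w n) (hfg : ∀ n, f n ≤ g n) : mean w f ≤ mean w g :=
  div_le_div_of_nonneg_right
    (hf.tsum_le_tsum (fun n => mul_le_mul_of_nonneg_right (hfg n) (hw n)) hg) (tsum_nonneg hw)

/-- The reindexing `n ↦ n + e_k` of a Gibbs sum: the identity `⟨a†_k a_k F⟩ = e^{-η_k}⟨a_k F a†_k⟩`
for diagonal `F`. Both moments of the particle number follow from it. -/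
lemma tsum_occupation_mul (η : ι → ℝ) (k : ι) (f : (ι →₀ ℕ) → ℝ) :
    ∑' n, ((n k : ℝ) * f n) * boltzmann η n =
      Real.exp (-η k) *
        ∑' n, (((n k : ℝ) + 1) * f (n + Finsupp.single k 1)) * boltzmann η n := by
  classical
  have hinj : Function.Injective fun n : ι →₀ ℕ => n + Finsupp.single k 1 :=
    add_left_injective _
  rw [← hinj.tsum_eq, ← tsum_mul_left]
  · refine tsum_congr fun n => ?_
    rw [boltzmann, additive_add, additive_single, neg_add, Real.exp_add, boltzmann]
    simp only [Finsupp.add_apply, Finsupp.single_eq_same, Nat.cast_add, Nat.cast_one, one_mul]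
    ring
  · intro n hn
    have hk : n k ≠ 0 := by
      intro h0
      exact hn (by simp [h0])
    refine ⟨n - Finsupp.single k 1, ?_⟩
    ext j
    by_cases hj : j = k
    · subst hj; simp; omega
    · simp [Ne.symm hj]

lemma IsFreeGas.tsum_pos {η : ι → ℝ} (h : IsFreeGas η) : 0 < ∑' n, boltzmann η n :=
  h.summable_boltzmann.tsum_pos (fun n => (boltzmann_pos η n).le) 0 (boltzmann_pos η 0)

lemma IsFreeGas.mean_add {η : ι → ℝ} (h : IsFreeGas η) {f g : (ι →₀ ℕ) → ℝ} {C D : ℝ}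
    (hf : ∀ n, |f n| ≤ C * (1 + particles n) ^ 2) (hg : ∀ n, |g n| ≤ D * (1 + particles n) ^ 2) :
    mean (boltzmann η) (fun n => f n + g n) =
      mean (boltzmann η) f + mean (boltzmann η) g :=
  BoseGas.mean_add (h.summable_mul hf) (h.summable_mul hg)

lemma eq_bose_mul {x A B : ℝ} (hx : 0 < x) (h : A = Real.exp (-x) * (A + B)) :
    A = bose x * B := by
  have h3 := exp_sub_one_pos hx
  rw [Real.exp_neg, inv_mul_eq_div, eq_div_iff (Real.exp_pos x).ne'] at h
  rw [bose, inv_mul_eq_div, eq_div_iff h3.ne']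
  linarith

lemma IsFreeGas.mean_occupation {η : ι → ℝ} (h : IsFreeGas η) (k : ι) :
    mean (boltzmann η) (fun n => (n k : ℝ)) = bose (η k) := by
  have h1 := tsum_occupation_mul η k (fun _ => 1)
  have h2 : mean (boltzmann η) (fun n => (n k : ℝ)) =
      Real.exp (-η k) * mean (boltzmann η) (fun n => (n k : ℝ) + 1) := by
    simp only [mul_one] at h1
    rw [mean, h1, mul_div_assoc, mean]
  rw [h.mean_add (abs_occupation_le k) abs_one_le, mean_one h.tsum_pos] at h2
  simpa using eq_bose_mul (h.pos k) h2

lemma IsFreeGas.mean_occupation_mul_particles {η : ι → ℝ} (h : IsFreeGas η) (k : ι) :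
    mean (boltzmann η) (fun n => (n k : ℝ) * particles n) =
      bose (η k) * (bose (η k) + 1 + mean (boltzmann η) particles) := by
  have h1 := tsum_occupation_mul η k particles
  have h2 : mean (boltzmann η) (fun n => (n k : ℝ) * particles n) = Real.exp (-η k) *
      mean (boltzmann η) (fun n => (n k : ℝ) * particles n + ((n k : ℝ) + (particles n + 1))) := by
    rw [mean, h1, mul_div_assoc, mean]
    congr 3
    funext n
    rw [particles_add_single]; push_cast; ring
  have hs1 : ∀ n : ι →₀ ℕ, |particles n + 1| ≤ 2 * (1 + particles n) ^ 2 := fun n =>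
    (abs_add_le _ _).trans (by linarith [abs_particles_le n, abs_one_le n])
  have hs2 : ∀ n : ι →₀ ℕ, |(n k : ℝ) + (particles n + 1)| ≤ 3 * (1 + particles n) ^ 2 := fun n =>
    (abs_add_le _ _).trans (by linarith [abs_occupation_le k n, hs1 n])
  rw [h.mean_add (abs_occupation_mul_particles_le k) hs2, h.mean_add (abs_occupation_le k) hs1,
    h.mean_add abs_particles_le abs_one_le, mean_one h.tsum_pos, h.mean_occupation] at h2
  rw [eq_bose_mul (h.pos k) h2]
  ring

/-- Summing an observable over all particles is the same as summing it over all modes. -/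
lemma hasSum_mean_occupation_mul {w F : (ι →₀ ℕ) → ℝ} (hw : ∀ n, 0 ≤ w n) (hF : ∀ n, 0 ≤ F n)
    (hs : Summable fun n => (particles n * F n) * w n) :
    HasSum (fun k => mean w fun n => (n k : ℝ) * F n) (mean w fun n => particles n * F n) := by
  have hn : ∀ n : ι →₀ ℕ, HasSum (fun k => ((n k : ℝ) * F n) * w n)
      ((particles n * F n) * w n) := by
    intro n
    refine HasSum.mul_right _ (HasSum.mul_right _ ?_)
    rw [particles, additive_eq_sum _ n subset_rfl]
    simp only [mul_one]
    exact hasSum_sum_of_ne_finset_zero fun k hk => by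
      simp [Finsupp.notMem_support_iff.1 hk]
  have hsum : Summable fun p : (ι →₀ ℕ) × ι => ((p.1 p.2 : ℝ) * F p.1) * w p.1 := by
    rw [summable_prod_of_nonneg fun p =>
      mul_nonneg (mul_nonneg (Nat.cast_nonneg _) (hF _)) (hw _)]
    exact ⟨fun n => (hn n).summable, by simpa only [(hn _).tsum_eq] using hs⟩
  have h1 : HasSum (fun k => ∑' n : ι →₀ ℕ, ((n k : ℝ) * F n) * w n)
      (∑' n, (particles n * F n) * w n) := by
    have h2 : ∑' n : ι →₀ ℕ, ∑' k, ((n k : ℝ) * F n) * w n = ∑' n, (particles n * F n) * w n :=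
      tsum_congr fun n => (hn n).tsum_eq
    rw [← h2, ← Summable.tsum_comm (f := fun (n : ι →₀ ℕ) k => ((n k : ℝ) * F n) * w n) hsum]
    exact (((Equiv.prodComm _ _).summable_iff.2 hsum).prod).hasSum
  simpa only [mean, div_eq_mul_inv] using h1.mul_right (∑' n, w n)⁻¹

lemma IsFreeGas.mean_particles {η : ι → ℝ} (h : IsFreeGas η) :
    mean (boltzmann η) particles = ∑' k, bose (η k) := by
  have := hasSum_mean_occupation_mul (w := boltzmann η) (F := fun _ => 1)
    (fun n => (boltzmann_pos η n).le) (fun _ => zero_le_one)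
    (by simpa using h.summable_mul abs_particles_le)
  simp only [mul_one, h.mean_occupation] at this
  exact this.tsum_eq.symm

/-- The variance of the particle number of a free Bose gas is `∑ k, g_k (1 + g_k)`, with `g_k`
the Bose–Einstein occupation numbers. -/
lemma IsFreeGas.hasSum_variance {η : ι → ℝ} (h : IsFreeGas η) :
    HasSum (fun k => bose (η k) * (bose (η k) + 1))
      (mean (boltzmann η) (fun n => particles n ^ 2) - (∑' k, bose (η k)) ^ 2) := by
  have := hasSum_mean_occupation_mul (w := boltzmann η) (F := particles)
    (fun n => (boltzmann_pos η n).le) particles_nonneg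
    (by simpa [← sq] using h.summable_mul abs_particles_sq_le)
  simp only [h.mean_occupation_mul_particles, h.mean_particles, ← sq] at this
  have h2 := this.sub (h.summable_bose.hasSum.mul_right (∑' k, bose (η k)))
  rw [← sq] at h2
  have h3 : (fun k => bose (η k) * (bose (η k) + 1)) =
      fun k => bose (η k) * (bose (η k) + 1 + ∑' k, bose (η k)) -
        bose (η k) * ∑' k, bose (η k) := by
    funext k; ring
  rw [h3]
  exact h2

end FreeGas

/-! ### The variational inequality for the mean-field gas -/

section Variational

variable {ι : Type*}

/-- Jensen's inequality for the exponential and the weights `w`. -/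
lemma exp_mean_le {w Φ : (ι →₀ ℕ) → ℝ} (hw : ∀ n, 0 ≤ w n) (hs : Summable w)
    (hZ : 0 < ∑' n, w n) (hΦ : Summable fun n => Φ n * w n)
    (hexp : Summable fun n => Real.exp (Φ n) * w n) :
    (∑' n, w n) * Real.exp (mean w Φ) ≤ ∑' n, Real.exp (Φ n) * w n := by
  set a := mean w Φ with ha
  -- the tangent of `exp` at the mean
  have h1 : ∀ n, Real.exp a * ((1 - a) * w n + Φ n * w n) ≤ Real.exp (Φ n) * w n := by
    intro n
    have h2 : Real.exp (Φ n) = Real.exp a * Real.exp (Φ n - a) := by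
      rw [← Real.exp_add]; ring_nf
    rw [h2, mul_assoc]
    refine mul_le_mul_of_nonneg_left ?_ (Real.exp_pos a).le
    nlinarith [Real.add_one_le_exp (Φ n - a), hw n]
  have h3 := (((hs.mul_left (1 - a)).add hΦ).mul_left (Real.exp a)).tsum_le_tsum h1 hexp
  rw [tsum_mul_left, (hs.mul_left (1 - a)).tsum_add hΦ, tsum_mul_left] at h3
  have h4 : ∑' n, Φ n * w n = a * ∑' n, w n := by
    rw [ha, mean, div_mul_cancel₀ _ hZ.ne']
  rw [h4] at h3
  nlinarith

/-- The unnormalised Gibbs weight `exp (-∑ k, n k * e k - κ N²)` of the mean-field gas with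
reduced one-particle energies `e` (which need not be positive) and reduced coupling `κ`. -/
def meanFieldWeight (e : ι → ℝ) (κ : ℝ) (n : ι →₀ ℕ) : ℝ :=
  Real.exp (-additive e n - κ * particles n ^ 2)

lemma meanFieldWeight_pos (e : ι → ℝ) (κ : ℝ) (n : ι →₀ ℕ) : 0 < meanFieldWeight e κ n :=
  Real.exp_pos _

lemma meanFieldWeight_eq (e η : ι → ℝ) (κ : ℝ) (n : ι →₀ ℕ) :
    meanFieldWeight e κ n =
      Real.exp (-additive (fun k => e k - η k) n - κ * particles n ^ 2) * boltzmann η n := by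
  rw [meanFieldWeight, boltzmann, ← Real.exp_add, additive_sub_left]; ring_nf

/-- The quadratic repulsion makes all Gibbs sums converge, for every bounded change of the
one-particle energies. -/
lemma summable_mul_meanFieldWeight {e η : ι → ℝ} (hη : IsFreeGas η) {κ D : ℝ} (hκ : 0 < κ)
    (hd : ∀ k, |e k - η k| ≤ D) {f : (ι →₀ ℕ) → ℝ} {C : ℝ}
    (hf : ∀ n, |f n| ≤ C * (1 + particles n) ^ 2) :
    Summable fun n => f n * meanFieldWeight e κ n := by
  refine Summable.of_norm_bounded
    (((hη.summable_mul hf).norm).mul_left (Real.exp (D ^ 2 / (4 * κ)))) fun n => ?_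
  rw [meanFieldWeight_eq e η, norm_mul, norm_mul, norm_mul, Real.norm_of_nonneg (Real.exp_pos _).le]
  rw [mul_left_comm]
  refine mul_le_mul_of_nonneg_right (Real.exp_le_exp.2 ?_) (by positivity)
  have h1 := (abs_le.1 (abs_additive_le hd n)).1
  have h2 : D * particles n - κ * particles n ^ 2 ≤ D ^ 2 / (4 * κ) := by
    rw [le_div_iff₀ (by positivity)]
    nlinarith [sq_nonneg (D - 2 * κ * particles n)]
  linarith

lemma summable_meanFieldWeight {e η : ι → ℝ} (hη : IsFreeGas η) {κ D : ℝ} (hκ : 0 < κ)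
    (hd : ∀ k, |e k - η k| ≤ D) : Summable (meanFieldWeight e κ) := by
  simpa using summable_mul_meanFieldWeight hη hκ hd abs_one_le

lemma tsum_meanFieldWeight_pos {e η : ι → ℝ} (hη : IsFreeGas η) {κ D : ℝ} (hκ : 0 < κ)
    (hd : ∀ k, |e k - η k| ≤ D) : 0 < ∑' n, meanFieldWeight e κ n :=
  (summable_meanFieldWeight hη hκ hd).tsum_pos (fun n => (meanFieldWeight_pos e κ n).le) 0
    (meanFieldWeight_pos e κ 0)

/-- The variational inequality on which everything rests. Two applications of Jensen's inequality
compare the mean-field Gibbs state with the free gas `η` to which `M` particles in the mode `k₀`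
have been added: one bounds the mean-field partition function above (by tilting the mean-field
state back to the free one), the other bounds it below (by using the shifted free gas as a trial
state). The partition functions cancel. -/
theorem mean_field_le {e η : ι → ℝ} (hη : IsFreeGas η) {κ D : ℝ} (hκ : 0 < κ)
    (hd : ∀ k, |e k - η k| ≤ D) (k₀ : ι) (M : ℕ) :
    κ * mean (meanFieldWeight e κ) (fun n => particles n ^ 2) +
        mean (meanFieldWeight e κ) (additive fun k => e k - η k) ≤
      κ * mean (boltzmann η) (fun n => (particles n + M) ^ 2) +
        mean (boltzmann η) (additive fun k => e k - η k) + M * e k₀ := by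
  have hD : 0 ≤ D := (abs_nonneg _).trans (hd k₀)
  set d : ι → ℝ := fun k => e k - η k with hd_def
  have hdn : ∀ n, |additive d n| ≤ D * (1 + particles n) ^ 2 := abs_additive_le_sq hd hD
  set W := meanFieldWeight e κ with hW
  set w := boltzmann η with hw
  have hWs : ∀ {f : (ι →₀ ℕ) → ℝ} {C : ℝ}, (∀ n, |f n| ≤ C * (1 + particles n) ^ 2) →
      Summable fun n => f n * W n := fun hf => summable_mul_meanFieldWeight hη hκ hd hf
  have hZW : 0 < ∑' n, W n := tsum_meanFieldWeight_pos hη hκ hd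
  have hZw : 0 < ∑' n, w n := hη.tsum_pos
  -- upper bound on the mean-field partition function
  set Ψ : (ι →₀ ℕ) → ℝ := fun n => κ * particles n ^ 2 + additive d n with hΨ
  have hκN : ∀ n : ι →₀ ℕ, |κ * particles n ^ 2| ≤ κ * (1 + particles n) ^ 2 := fun n => by
    rw [abs_mul, abs_of_pos hκ]
    exact mul_le_mul_of_nonneg_left (by linarith [abs_particles_sq_le n]) hκ.le
  have hΨn : ∀ n, |Ψ n| ≤ (κ + D) * (1 + particles n) ^ 2 := fun n =>
    (abs_add_le _ _).trans (by linarith [hκN n, hdn n])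
  have hback : ∀ n, Real.exp (Ψ n) * W n = w n := fun n => by
    rw [hW, meanFieldWeight_eq e η, ← mul_assoc, ← Real.exp_add, hΨ]
    simp only [hd_def, hw]
    rw [show ∀ a b : ℝ, a + b + (-b - a) = 0 by intros; ring, Real.exp_zero, one_mul]
  have h1 := exp_mean_le (fun n => (meanFieldWeight_pos e κ n).le)
    (summable_meanFieldWeight hη hκ hd) hZW (hWs hΨn)
    (hη.summable_boltzmann.congr fun n => (hback n).symm)
  rw [tsum_congr hback] at h1
  -- lower bound: the trial state
  set Φ : (ι →₀ ℕ) → ℝ :=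
    fun n => (-M * d k₀) + ((-κ) * (particles n + M) ^ 2 + (-1) * additive d n) with hΦ
  have hM : ∀ n : ι →₀ ℕ, |(particles n + M) ^ 2| ≤ (1 + M) ^ 2 * (1 + particles n) ^ 2 :=
    fun n => by
      have := particles_nonneg n
      rw [abs_of_nonneg (sq_nonneg _), ← mul_pow]
      have hM0 : (0 : ℝ) ≤ M := Nat.cast_nonneg M
      exact pow_le_pow_left₀ (by positivity) (by nlinarith) 2
  have hΦ1 : Summable fun n => ((-κ) * (particles n + M) ^ 2) * w n := by
    simpa only [mul_assoc] using (hη.summable_mul hM).mul_left (-κ)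
  have hΦ2 : Summable fun n => ((-1) * additive d n) * w n := by
    simpa only [mul_assoc] using (hη.summable_mul hdn).mul_left (-1)
  have hΦ0 : Summable fun n => (-M * d k₀ * 1) * w n := by
    simpa only [mul_one] using hη.summable_boltzmann.mul_left (-M * d k₀)
  have hΦ12 : Summable fun n => ((-κ) * (particles n + M) ^ 2 + (-1) * additive d n) * w n := by
    simpa only [add_mul] using hΦ1.add hΦ2
  have hΦs : Summable fun n => Φ n * w n := by
    simpa only [hΦ, add_mul, mul_one] using hΦ0.add hΦ12
  have hshift : ∀ n, Real.exp (Φ n) * w n =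
      Real.exp (M * η k₀) * W (n + Finsupp.single k₀ M) := fun n => by
    rw [hW, meanFieldWeight, hw, boltzmann, ← Real.exp_add, ← Real.exp_add,
      particles_add_single, additive_add, additive_single, hΦ]
    simp only [hd_def, additive_sub_left]
    ring_nf
  have hinj : Function.Injective fun n : ι →₀ ℕ => n + Finsupp.single k₀ M :=
    add_left_injective _
  have hWsum := summable_meanFieldWeight hη hκ hd
  have h2 := exp_mean_le (fun n => (boltzmann_pos η n).le) hη.summable_boltzmann hZw hΦs
    (((hWsum.comp_injective hinj).mul_left _).congr fun n => (hshift n).symm)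
  rw [tsum_congr hshift, tsum_mul_left] at h2
  have h3 : ∑' n, W (n + Finsupp.single k₀ M) ≤ ∑' n, W n :=
    tsum_comp_le_tsum_of_inj hWsum (fun n => (meanFieldWeight_pos e κ n).le) hinj
  -- combine
  have h4 : Real.exp (mean w Φ + mean W Ψ) ≤ Real.exp (M * η k₀) := by
    have h5 : (∑' n, w n) * Real.exp (mean w Φ) ≤ Real.exp (M * η k₀) * ∑' n, W n :=
      h2.trans (mul_le_mul_of_nonneg_left h3 (Real.exp_pos _).le)
    have h6 : (∑' n, W n) * (Real.exp (mean W Ψ) * Real.exp (mean w Φ)) ≤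
        (∑' n, W n) * Real.exp (M * η k₀) := by
      calc _ = ((∑' n, W n) * Real.exp (mean W Ψ)) * Real.exp (mean w Φ) := by ring
        _ ≤ (∑' n, w n) * Real.exp (mean w Φ) :=
          mul_le_mul_of_nonneg_right h1 (Real.exp_pos _).le
        _ ≤ _ := by linarith
    rw [Real.exp_add, mul_comm]
    exact le_of_mul_le_mul_left h6 hZW
  have h7 := Real.exp_le_exp.1 h4
  have h8 : mean W Ψ = κ * mean W (fun n => particles n ^ 2) + mean W (additive d) := by
    rw [hΨ, mean_add (hWs hκN) (hWs hdn), mean_const_mul]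
  have h9 : mean w Φ = -M * d k₀ +
      (-κ * mean w (fun n => (particles n + M) ^ 2) + -1 * mean w (additive d)) := by
    have h10 := mean_add hΦ0 hΦ12
    rw [mean_const_mul, mean_one hZw, mean_add hΦ1 hΦ2, mean_const_mul, mean_const_mul] at h10
    simpa only [mul_one] using h10
  rw [h8, h9] at h7
  simp only [hd_def] at h7 ⊢
  linarith

end Variational

/-! ### The operators are diagonal in the occupation numbers -/

section Operators

variable {ν : ℕ}

lemma modeNumber_ket (k : Mode ν) (n : Occ ν) : modeNumber k (ket n) = (n k : ℂ) • ket n := by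
  simp only [modeNumber, Module.End.mul_apply, annihilation, ket,
    Finsupp.linearCombination_single, one_smul, map_smul, creation]
  by_cases h : n k = 0
  · simp [h]
  · have h1 : n - Finsupp.single k 1 + Finsupp.single k 1 = n := by
      ext j
      by_cases hj : j = k
      · subst hj; simp; omega
      · simp [Ne.symm hj]
    have h2 : (((n - Finsupp.single k 1 : Occ ν) k : ℕ) : ℝ) + 1 = n k := by
      have : (n - Finsupp.single k 1 : Occ ν) k = n k - 1 := by simp
      rw [this]
      have : n k - 1 + 1 = n k := by omega
      exact_mod_cast this
    rw [h1, h2, smul_smul, ← Complex.ofReal_mul, Real.mul_self_sqrt (Nat.cast_nonneg _)]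
    simp

lemma modeSum_ket (c : Mode ν → ℝ) (n : Occ ν) :
    modeSum c (ket n) = ((additive c n : ℝ) : ℂ) • ket n := by
  have h0 : modeSum c (ket n) = ∑ᶠ k : Mode ν, (c k : ℂ) • modeNumber k (ket n) := by
    simp [modeSum, ket]
  rw [h0, finsum_eq_sum_of_support_subset (s := n.support), additive_eq_sum c n subset_rfl]
  · simp only [modeNumber_ket, smul_smul, ← Finset.sum_smul]
    push_cast
    simp only [mul_comm]
  · intro k hk
    simp only [Finset.mem_coe, Finsupp.mem_support_iff]
    intro h
    exact hk (by simp [modeNumber_ket, h])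

lemma totalNumber_ket (n : Occ ν) : totalNumber ν (ket n) = ((particles n : ℝ) : ℂ) • ket n :=
  modeSum_ket _ n

lemma totalNumber_sq_ket (n : Occ ν) :
    (totalNumber ν ^ 2) (ket n) = ((particles n ^ 2 : ℝ) : ℂ) • ket n := by
  rw [sq, Module.End.mul_apply, totalNumber_ket, map_smul, totalNumber_ket, smul_smul]
  push_cast
  rw [sq]

/-- The reduced one-particle energies `β (|k|² - Δ δ_{k,0} - μ)` in the box of side `L`. -/
def reducedEnergy (ν : ℕ) (L Δ β μ : ℝ) (k : Mode ν) : ℝ :=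
  β * (modeEnergy L k - (if k = 0 then Δ else 0) - μ)

lemma hamiltonian_ket (L Δ lam β μ : ℝ) (n : Occ ν) :
    ((-β : ℂ) • (meanFieldHamiltonian ν L Δ lam - (μ : ℂ) • totalNumber ν)) (ket n) =
      ((-additive (reducedEnergy ν L Δ β μ) n - β * lam / (2 * L ^ ν) * particles n ^ 2 : ℝ) : ℂ)
        • ket n := by
  have h : additive (reducedEnergy ν L Δ β μ) n =
      β * (additive (modeEnergy L) n - Δ * n 0 - μ * particles n) := by
    unfold reducedEnergy
    rw [additive_const_mul, additive_sub_left, additive_sub_left, additive_const, additive_ite]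
    ring
  simp only [LinearMap.smul_apply, LinearMap.sub_apply, LinearMap.add_apply,
    meanFieldHamiltonian, kinetic, modeSum_ket, modeNumber_ket, totalNumber_ket,
    totalNumber_sq_ket, smul_smul, ← sub_smul, ← add_smul, h]
  congr 1
  push_cast
  ring

lemma pow_apply_of_eigen {A : Module.End ℂ (Core ν)} {ψ : Core ν} {E : ℂ} (h : A ψ = E • ψ)
    (j : ℕ) : (A ^ j) ψ = E ^ j • ψ := by
  induction j with
  | zero => simp
  | succ j ih => rw [pow_succ, Module.End.mul_apply, h, map_smul, ih, smul_smul, pow_succ']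

lemma expOp_of_eigen {A : Module.End ℂ (Core ν)} {ψ : Core ν} {E : ℂ} (h : A ψ = E • ψ) :
    expOp A ψ = Complex.exp E • toFock ν ψ := by
  have h1 : HasSum (fun j : ℕ => ((j.factorial : ℂ)⁻¹) • E ^ j) (Complex.exp E) := by
    rw [Complex.exp_eq_exp_ℂ]
    exact NormedSpace.exp_series_hasSum_exp' E
  have h2 := h1.smul_const (toFock ν ψ)
  rw [expOp, ← h2.tsum_eq]
  refine tsum_congr fun j => ?_
  rw [pow_apply_of_eigen h, map_smul, smul_smul, smul_eq_mul]

lemma inner_toFock_ket (n : Occ ν) :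
    inner ℂ (toFock ν (ket n)) (toFock ν (ket n)) = (1 : ℂ) := by
  simp [toFock, ket]

/-- The diagonal matrix elements of `e^{-β(H - μN)} B` for a diagonal observable `B`. -/
lemma gibbsDiag_eq (L Δ lam β μ : ℝ) {B : Module.End ℂ (Core ν)} {b : Occ ν → ℝ}
    (hB : ∀ n, B (ket n) = (b n : ℂ) • ket n) :
    gibbsDiag ν L Δ lam β μ B = fun n =>
      ((b n * meanFieldWeight (reducedEnergy ν L Δ β μ) (β * lam / (2 * L ^ ν)) n : ℝ) : ℂ) := by
  funext n
  have h : ((-β : ℂ) • (meanFieldHamiltonian ν L Δ lam - (μ : ℂ) • totalNumber ν))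
      ((b n : ℂ) • ket n) = ((-additive (reducedEnergy ν L Δ β μ) n -
        β * lam / (2 * L ^ ν) * particles n ^ 2 : ℝ) : ℂ) • ((b n : ℂ) • ket n) := by
    rw [map_smul, hamiltonian_ket, smul_comm]
  rw [gibbsDiag, hB, expOp_of_eigen h, map_smul, inner_smul_right, inner_smul_right,
    inner_toFock_ket, meanFieldWeight, mul_one, Complex.ofReal_mul, Complex.ofReal_exp, mul_comm]

lemma gibbsDiag_one (L Δ lam β μ : ℝ) :
    gibbsDiag ν L Δ lam β μ 1 = fun n =>
      ((meanFieldWeight (reducedEnergy ν L Δ β μ) (β * lam / (2 * L ^ ν)) n : ℝ) : ℂ) := by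
  rw [gibbsDiag_eq L Δ lam β μ (b := fun _ => 1) (by simp)]
  simp

/-- For diagonal observables the quantum Gibbs expectation is the mean over occupation numbers. -/
lemma gibbsMean_eq (L Δ lam β μ : ℝ) {B : Module.End ℂ (Core ν)} {b : Occ ν → ℝ}
    (hB : ∀ n, B (ket n) = (b n : ℂ) • ket n) :
    gibbsMean ν L Δ lam β μ B =
      (mean (meanFieldWeight (reducedEnergy ν L Δ β μ) (β * lam / (2 * L ^ ν))) b : ℝ) := by
  rw [gibbsMean, gibbsDiag_eq L Δ lam β μ hB, gibbsDiag_one, mean, Complex.ofReal_div,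
    Complex.ofReal_tsum, Complex.ofReal_tsum]

lemma gibbsDefined_of_summable {L Δ lam β μ : ℝ} {B : Module.End ℂ (Core ν)} {b : Occ ν → ℝ}
    (hB : ∀ n, B (ket n) = (b n : ℂ) • ket n)
    (h1 : Summable (meanFieldWeight (reducedEnergy ν L Δ β μ) (β * lam / (2 * L ^ ν))))
    (h2 : Summable fun n =>
      b n * meanFieldWeight (reducedEnergy ν L Δ β μ) (β * lam / (2 * L ^ ν)) n) :
    GibbsDefined ν L Δ lam β μ B := by
  refine ⟨?_, ?_, ?_⟩
  · rw [gibbsDiag_one]; exact Complex.ofRealCLM.summable h1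
  · rw [gibbsDiag_one, ← Complex.ofReal_tsum, Complex.ofReal_ne_zero]
    exact (h1.tsum_pos (fun n => (meanFieldWeight_pos _ _ n).le) 0
      (meanFieldWeight_pos _ _ 0)).ne'
  · rw [gibbsDiag_eq L Δ lam β μ hB]; exact Complex.ofRealCLM.summable h2

end Operators

/-! ### The density of the perfect gas -/

section PerfectGas

open MeasureTheory

lemma bose_antitone {x y : ℝ} (hx : 0 < x) (hxy : x ≤ y) : bose y ≤ bose x :=
  inv_anti₀ (exp_sub_one_pos hx) (by linarith [Real.exp_le_exp.2 hxy])

lemma bose_le_gaussian {β a y : ℝ} (hβ : 0 < β) (ha : a < 0) (hy : 0 ≤ y) :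
    bose (β * (y - a)) ≤ bose (-(β * a)) * Real.exp (-(β * y)) := by
  have h0 : 0 < -(β * a) := by nlinarith
  have h1 := exp_sub_one_pos h0
  have h2 : 1 ≤ Real.exp (β * y) := Real.one_le_exp (by positivity)
  rw [bose, bose, Real.exp_neg (β * y), ← mul_inv]
  refine inv_anti₀ (by positivity) ?_
  have h3 : Real.exp (β * (y - a)) = Real.exp (-(β * a)) * Real.exp (β * y) := by
    rw [← Real.exp_add]; ring_nf
  rw [h3]
  nlinarith

lemma continuousAt_bose {x : ℝ} (hx : 0 < x) : ContinuousAt bose x :=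
  ((Real.continuous_exp.continuousAt).sub continuousAt_const).inv₀ (exp_sub_one_pos hx).ne'

lemma measurable_bose : Measurable bose := by unfold bose; fun_prop

variable {ν : ℕ}

lemma integrable_gaussian {b : ℝ} (hb : 0 < b) :
    Integrable fun x : Fin ν → ℝ => Real.exp (-(b * ∑ i, x i ^ 2)) := by
  have h := Integrable.fintype_prod (ι := Fin ν) (f := fun _ (t : ℝ) => Real.exp (-b * t ^ 2))
    (μ := fun _ => volume) (fun _ => integrable_exp_neg_mul_sq hb)
  refine h.congr (Eventually.of_forall fun x => ?_)
  simp only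
  rw [← Real.exp_sum, Finset.mul_sum, ← Finset.sum_neg_distrib]
  simp only [neg_mul]

lemma integrable_bose {β a : ℝ} (hβ : 0 < β) (ha : a < 0) :
    Integrable fun x : Fin ν → ℝ => bose (β * (∑ i, x i ^ 2 - a)) := by
  refine ((integrable_gaussian hβ).const_mul (bose (-(β * a)))).mono'
    (measurable_bose.comp (by fun_prop)).aestronglyMeasurable
    (Eventually.of_forall fun x => ?_)
  have hy : 0 ≤ ∑ i, x i ^ 2 := Finset.sum_nonneg fun _ _ => sq_nonneg _
  rw [Real.norm_of_nonneg (bose_pos (by nlinarith)).le]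
  exact bose_le_gaussian hβ ha hy

lemma bose_norm_eq (β a : ℝ) :
    (fun k : EuclideanSpace ℝ (Fin ν) => (Real.exp (β * (‖k‖ ^ 2 - a)) - 1)⁻¹) =
      (fun x : Fin ν → ℝ => bose (β * (∑ i, x i ^ 2 - a))) ∘ WithLp.ofLp := by
  funext k
  simp [bose, EuclideanSpace.real_norm_sq_eq]

lemma integrable_bose_norm {β a : ℝ} (hβ : 0 < β) (ha : a < 0) :
    Integrable fun k : EuclideanSpace ℝ (Fin ν) => (Real.exp (β * (‖k‖ ^ 2 - a)) - 1)⁻¹ := by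
  rw [bose_norm_eq]
  exact (PiLp.volume_preserving_ofLp (Fin ν)).integrable_comp_of_integrable (integrable_bose hβ ha)

lemma perfectDensity_eq (β a : ℝ) :
    perfectDensity ν β a =
      ((2 * Real.pi) ^ ν)⁻¹ * ∫ x : Fin ν → ℝ, bose (β * (∑ i, x i ^ 2 - a)) := by
  rw [perfectDensity, bose_norm_eq]
  congr 1
  exact (PiLp.volume_preserving_ofLp (Fin ν)).integral_comp
    (MeasurableEquiv.toLp 2 (Fin ν → ℝ)).symm.measurableEmbedding
    (fun x : Fin ν → ℝ => bose (β * (∑ i, x i ^ 2 - a)))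

lemma perfectDensity_nonneg {β a : ℝ} (hβ : 0 < β) (ha : a < 0) : 0 ≤ perfectDensity ν β a := by
  rw [perfectDensity_eq]
  refine mul_nonneg (by positivity) (integral_nonneg fun x => (bose_pos ?_).le)
  have hy : 0 ≤ ∑ i, x i ^ 2 := Finset.sum_nonneg fun _ _ => sq_nonneg _
  nlinarith

lemma perfectDensity_mono {β a b : ℝ} (hβ : 0 < β) (hab : a ≤ b) (hb : b < 0) :
    perfectDensity ν β a ≤ perfectDensity ν β b := by
  rw [perfectDensity_eq, perfectDensity_eq]
  refine mul_le_mul_of_nonneg_left (integral_mono (integrable_bose hβ (hab.trans_lt hb))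
    (integrable_bose hβ hb) fun x => bose_antitone ?_ ?_) (by positivity)
  · have hy : 0 ≤ ∑ i, x i ^ 2 := Finset.sum_nonneg fun _ _ => sq_nonneg _
    nlinarith
  · nlinarith

lemma continuousAt_perfectDensity {β a : ℝ} (hβ : 0 < β) (ha : a < 0) :
    ContinuousAt (perfectDensity ν β) a := by
  rw [show perfectDensity ν β = fun a => ((2 * Real.pi) ^ ν)⁻¹ *
    ∫ x : Fin ν → ℝ, bose (β * (∑ i, x i ^ 2 - a)) from funext fun a => perfectDensity_eq β a]
  refine continuousAt_const.mul (continuousAt_of_dominated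
    (bound := fun x => bose (β * (∑ i, x i ^ 2 - a / 2))) ?_ ?_
    (integrable_bose hβ (by linarith)) ?_)
  · exact Eventually.of_forall fun b => (measurable_bose.comp (by fun_prop)).aestronglyMeasurable
  · filter_upwards [Iio_mem_nhds (show a < a / 2 by linarith)] with b hb
    refine Eventually.of_forall fun x => ?_
    have hy : 0 ≤ ∑ i, x i ^ 2 := Finset.sum_nonneg fun _ _ => sq_nonneg _
    have hb' : b < a / 2 := hb
    rw [Real.norm_of_nonneg (bose_pos (by nlinarith)).le]
    exact bose_antitone (by nlinarith) (by nlinarith)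
  · refine Eventually.of_forall fun x => ?_
    have hy : 0 ≤ ∑ i, x i ^ 2 := Finset.sum_nonneg fun _ _ => sq_nonneg _
    exact ContinuousAt.comp (f := fun a => β * (∑ i, x i ^ 2 - a)) (g := bose)
      (continuousAt_bose (by nlinarith)) (by fun_prop)

/-- The energy `∑ i, (h ⌊x i / h⌋)²` of the lattice point of `hℤ^ν` at the lower corner of the cell
containing `x`. -/
def cellEnergy (h : ℝ) (x : Fin ν → ℝ) : ℝ := ∑ i, (h * (⌊x i / h⌋ : ℝ)) ^ 2

lemma abs_sub_cell_le {h : ℝ} (hh : 0 < h) (t : ℝ) : |h * (⌊t / h⌋ : ℝ) - t| ≤ h := by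
  have h1 : (⌊t / h⌋ : ℝ) ≤ t / h := Int.floor_le _
  have h2 : t / h < ⌊t / h⌋ + 1 := Int.lt_floor_add_one _
  rw [le_div_iff₀ hh] at h1
  rw [div_lt_iff₀ hh] at h2
  rw [abs_le]
  constructor <;> linarith

lemma cellEnergy_nonneg (h : ℝ) (x : Fin ν → ℝ) : 0 ≤ cellEnergy h x :=
  Finset.sum_nonneg fun _ _ => sq_nonneg _

lemma le_cellEnergy {h : ℝ} (hh : 0 < h) (x : Fin ν → ℝ) :
    (∑ i, x i ^ 2) / 2 - ν * h ^ 2 ≤ cellEnergy h x := by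
  have : ∑ i, (x i ^ 2 / 2 - h ^ 2) ≤ cellEnergy h x := by
    refine Finset.sum_le_sum fun i _ => ?_
    have := abs_le.1 (abs_sub_cell_le hh (x i))
    nlinarith [sq_nonneg (h * (⌊x i / h⌋ : ℝ) + (h * (⌊x i / h⌋ : ℝ) - x i))]
  simpa [Finset.sum_sub_distrib, Finset.sum_div] using this

lemma measurable_cellEnergy (h : ℝ) : Measurable (cellEnergy h : (Fin ν → ℝ) → ℝ) := by
  unfold cellEnergy
  refine Finset.measurable_sum _ fun i _ => ?_
  have h1 : Measurable fun x : Fin ν → ℝ => ⌊x i / h⌋ :=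
    Int.measurable_floor.comp (Measurable.div_const (by fun_prop) h)
  have h2 : Measurable fun z : ℤ => (z : ℝ) := measurable_from_top
  exact ((h2.comp h1).const_mul h).pow_const 2

lemma bose_cellEnergy_le {β a h : ℝ} (hβ : 0 < β) (ha : a < 0) (hh : 0 < h) (x : Fin ν → ℝ) :
    ‖bose (β * (cellEnergy h x - a))‖ ≤
      bose (-(β * a)) * Real.exp (β * (ν * h ^ 2)) * Real.exp (-(β / 2 * ∑ i, x i ^ 2)) := by
  have h0 := cellEnergy_nonneg h x
  rw [Real.norm_of_nonneg (bose_pos (by nlinarith)).le, mul_assoc, ← Real.exp_add]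
  refine (bose_le_gaussian hβ ha h0).trans (mul_le_mul_of_nonneg_left
    (Real.exp_le_exp.2 ?_) (bose_pos (by nlinarith)).le)
  nlinarith [le_cellEnergy hh x]

lemma integrable_bose_cellEnergy {β a h : ℝ} (hβ : 0 < β) (ha : a < 0) (hh : 0 < h) :
    Integrable fun x : Fin ν → ℝ => bose (β * (cellEnergy h x - a)) :=
  ((integrable_gaussian (half_pos hβ)).const_mul _).mono'
    (measurable_bose.comp (((measurable_cellEnergy h).sub_const a).const_mul β)).aestronglyMeasurable
    (Eventually.of_forall fun x => bose_cellEnergy_le hβ ha hh x)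

/-- The sum over the modes of the box is an integral of a function that is constant on the cells
of the dual lattice. -/
lemma hasSum_bose_modeEnergy {β a L : ℝ} (hβ : 0 < β) (ha : a < 0) (hL : 0 < L) :
    HasSum (fun m : Mode ν => (2 * Real.pi / L) ^ ν * bose (β * (modeEnergy L m - a)))
      (∫ x : Fin ν → ℝ, bose (β * (cellEnergy (2 * Real.pi / L) x - a))) := by
  set h := 2 * Real.pi / L with h_def
  have hh : 0 < h := by positivity
  set Q : Mode ν → Set (Fin ν → ℝ) :=
    fun m => Set.univ.pi fun i => Set.Ico (h * m i) (h * m i + h) with hQ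
  have hmem : ∀ (m : Mode ν) (x : Fin ν → ℝ), x ∈ Q m ↔ ∀ i, ⌊x i / h⌋ = m i := by
    intro m x
    simp only [hQ, Set.mem_pi, Set.mem_univ, true_imp_iff, Set.mem_Ico]
    refine forall_congr' fun i => ?_
    rw [Int.floor_eq_iff, le_div_iff₀ hh, div_lt_iff₀ hh]
    constructor <;> rintro ⟨h1, h2⟩ <;> constructor <;> linarith
  have hcover : ⋃ m, Q m = Set.univ :=
    Set.eq_univ_of_forall fun x => Set.mem_iUnion.2 ⟨fun i => ⌊x i / h⌋, (hmem _ _).2 fun _ => rfl⟩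
  have hdisj : Pairwise (Function.onFun Disjoint Q) := fun m m' hne =>
    Set.disjoint_left.2 fun x hx hx' =>
      hne (funext fun i => ((hmem m x).1 hx i).symm.trans ((hmem m' x).1 hx' i))
  have hmeas : ∀ m, MeasurableSet (Q m) := fun m =>
    MeasurableSet.univ_pi fun i => measurableSet_Ico
  have hsum := hasSum_integral_iUnion (μ := volume) hmeas hdisj
    (f := fun x => bose (β * (cellEnergy h x - a)))
    (integrable_bose_cellEnergy hβ ha hh).integrableOn
  rw [hcover, setIntegral_univ] at hsum
  refine hsum.congr_fun ?_
  intro m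
  have hconst : ∀ x ∈ Q m, bose (β * (cellEnergy h x - a)) = bose (β * (modeEnergy L m - a)) := by
    intro x hx
    have : cellEnergy h x = modeEnergy L m := by
      refine Finset.sum_congr rfl fun i _ => ?_
      rw [(hmem m x).1 hx i, h_def]; ring
    rw [this]
  rw [setIntegral_congr_fun (hmeas m) hconst, setIntegral_const, smul_eq_mul]
  congr 1
  rw [Measure.real, hQ, Real.volume_pi_Ico_toReal (fun i => by simp [hh.le])]
  simp

lemma summable_bose_modeEnergy {β a L : ℝ} (hβ : 0 < β) (ha : a < 0) (hL : 0 < L) :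
    Summable fun m : Mode ν => bose (β * (modeEnergy L m - a)) :=
  (summable_mul_left_iff (by positivity)).1 (hasSum_bose_modeEnergy hβ ha hL).summable

/-- The density of the perfect gas in the box converges to `perfectDensity`: the mode sum is a
Riemann sum, dominated by a Gaussian. -/
theorem tendsto_tsum_bose {β a : ℝ} (hβ : 0 < β) (ha : a < 0) :
    Tendsto (fun L : ℝ => (∑' m : Mode ν, bose (β * (modeEnergy L m - a))) / L ^ ν) atTop
      (𝓝 (perfectDensity ν β a)) := by
  have h0 : Tendsto (fun L : ℝ => 2 * Real.pi / L) atTop (𝓝 0) :=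
    tendsto_const_nhds.div_atTop tendsto_id
  have hpos : ∀ᶠ L : ℝ in atTop, 0 < L := eventually_gt_atTop 0
  have h1 : ∀ᶠ L : ℝ in atTop, 2 * Real.pi / L < 1 := h0.eventually_lt_const one_pos
  have key : Tendsto (fun L : ℝ =>
      ∫ x : Fin ν → ℝ, bose (β * (cellEnergy (2 * Real.pi / L) x - a))) atTop
      (𝓝 (∫ x : Fin ν → ℝ, bose (β * (∑ i, x i ^ 2 - a)))) := by
    refine tendsto_integral_filter_of_dominated_convergence
      (fun x => bose (-(β * a)) * Real.exp (β * ν) * Real.exp (-(β / 2 * ∑ i, x i ^ 2))) ?_ ?_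
      ((integrable_gaussian (half_pos hβ)).const_mul _) ?_
    · exact Eventually.of_forall fun L => (measurable_bose.comp
        (((measurable_cellEnergy _).sub_const a).const_mul β)).aestronglyMeasurable
    · filter_upwards [hpos, h1] with L hL hL1
      refine Eventually.of_forall fun x => ?_
      have hh : 0 < 2 * Real.pi / L := by positivity
      refine (bose_cellEnergy_le hβ ha hh x).trans ?_
      refine mul_le_mul_of_nonneg_right (mul_le_mul_of_nonneg_left (Real.exp_le_exp.2 ?_)
        (bose_pos (by nlinarith)).le) (Real.exp_pos _).le
      have : (2 * Real.pi / L) ^ 2 ≤ 1 := pow_le_one₀ hh.le hL1.le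
      have hν : (0 : ℝ) ≤ ν := Nat.cast_nonneg ν
      exact mul_le_mul_of_nonneg_left (by nlinarith) hβ.le
    · refine Eventually.of_forall fun x => ?_
      have hy : 0 ≤ ∑ i, x i ^ 2 := Finset.sum_nonneg fun _ _ => sq_nonneg _
      have hcell : Tendsto (fun L : ℝ => cellEnergy (2 * Real.pi / L) x) atTop
          (𝓝 (∑ i, x i ^ 2)) := by
        refine tendsto_finsetSum _ fun i _ => Tendsto.pow ?_ 2
        rw [tendsto_iff_norm_sub_tendsto_zero]
        refine squeeze_zero' (Eventually.of_forall fun _ => norm_nonneg _) ?_ h0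
        filter_upwards [hpos] with L hL
        exact abs_sub_cell_le (by positivity) (x i)
      exact (continuousAt_bose (by nlinarith)).tendsto.comp ((hcell.sub_const a).const_mul β)
  rw [perfectDensity_eq]
  refine (key.const_mul _).congr' ?_
  filter_upwards [hpos] with L hL
  rw [← (hasSum_bose_modeEnergy hβ ha hL).tsum_eq, tsum_mul_left, div_pow]
  have : (2 * Real.pi) ^ ν ≠ 0 := by positivity
  field_simp

end PerfectGas

/-! ### The gas in the box -/

section Box

variable {ν : ℕ}

lemma modeEnergy_nonneg (L : ℝ) (k : Mode ν) : 0 ≤ modeEnergy L k :=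
  Finset.sum_nonneg fun _ _ => sq_nonneg _

lemma modeEnergy_zero (L : ℝ) : modeEnergy L (0 : Mode ν) = 0 := by simp [modeEnergy]

/-- Reduced energies of a reference perfect gas in the box, at chemical potential `a` in all modes
except the zero mode, which has the reduced energy `β t`. -/
def referenceEnergy (ν : ℕ) (L β a t : ℝ) (k : Mode ν) : ℝ :=
  if k = 0 then β * t else β * (modeEnergy L k - a)

lemma hasSum_bose_referenceEnergy {L β a : ℝ} (t : ℝ) (hβ : 0 < β) (ha : a < 0) (hL : 0 < L) :
    HasSum (fun k => bose (referenceEnergy ν L β a t k))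
      (bose (β * t) - bose (β * -a) + ∑' m : Mode ν, bose (β * (modeEnergy L m - a))) := by
  have h := (summable_bose_modeEnergy (ν := ν) hβ ha hL).hasSum.update 0 (bose (β * t))
  rw [modeEnergy_zero, zero_sub] at h
  have h2 : (fun k => bose (referenceEnergy ν L β a t k)) =
      Function.update (fun m : Mode ν => bose (β * (modeEnergy L m - a))) 0 (bose (β * t)) := by
    funext k
    by_cases hk : k = 0
    · subst hk; simp [referenceEnergy]
    · simp [referenceEnergy, hk]
  rw [h2]
  exact h

lemma min_le_referenceEnergy {L β a t : ℝ} (hβ : 0 < β) (k : Mode ν) :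
    min (β * t) (β * -a) ≤ referenceEnergy ν L β a t k := by
  unfold referenceEnergy
  split_ifs
  · exact min_le_left _ _
  · exact (min_le_right _ _).trans
      (mul_le_mul_of_nonneg_left (by linarith [modeEnergy_nonneg L k]) hβ.le)

lemma isFreeGas_referenceEnergy {L β a t : ℝ} (hβ : 0 < β) (ha : a < 0) (ht : 0 < t)
    (hL : 0 < L) : IsFreeGas (referenceEnergy ν L β a t) :=
  ⟨⟨min (β * t) (β * -a), lt_min (by positivity) (by nlinarith), min_le_referenceEnergy hβ⟩,
    (hasSum_bose_referenceEnergy t hβ ha hL).summable⟩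

/-- The weights of the mean-field gas with gap `Δ` in the box. -/
def boxWeight (ν : ℕ) (L Δ lam β μ : ℝ) : Occ ν → ℝ :=
  meanFieldWeight (reducedEnergy ν L Δ β μ) (β * lam / (2 * L ^ ν))

lemma reducedEnergy_sub (L Δ β μ a t : ℝ) :
    (fun k => reducedEnergy ν L Δ β μ k - referenceEnergy ν L β a t k) =
      fun k => if k = 0 then -(β * (Δ + μ + t)) else β * (a - μ) := by
  funext k
  unfold reducedEnergy referenceEnergy
  split_ifs with hk
  · subst hk; rw [modeEnergy_zero]; ring
  · ring

lemma abs_reducedEnergy_sub_le (L Δ β μ a t : ℝ) (k : Mode ν) :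
    |reducedEnergy ν L Δ β μ k - referenceEnergy ν L β a t k| ≤
      max |-(β * (Δ + μ + t))| |β * (a - μ)| := by
  rw [congrFun (reducedEnergy_sub L Δ β μ a t) k]
  split_ifs
  · exact le_max_left _ _
  · exact le_max_right _ _

lemma summable_mul_boxWeight {L Δ lam β μ : ℝ} (hL : 0 < L) (hlam : 0 < lam) (hβ : 0 < β)
    {f : Occ ν → ℝ} {C : ℝ} (hf : ∀ n, |f n| ≤ C * (1 + particles n) ^ 2) :
    Summable fun n => f n * boxWeight ν L Δ lam β μ n :=
  summable_mul_meanFieldWeight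
    (isFreeGas_referenceEnergy (a := -1) (t := 1) hβ (by norm_num) one_pos hL) (by positivity)
    (abs_reducedEnergy_sub_le L Δ β μ (-1) 1) hf

lemma summable_boxWeight {L Δ lam β μ : ℝ} (hL : 0 < L) (hlam : 0 < lam) (hβ : 0 < β) :
    Summable (boxWeight ν L Δ lam β μ) := by
  simpa using summable_mul_boxWeight hL hlam hβ abs_one_le

lemma boxWeight_nonneg (L Δ lam β μ : ℝ) (n : Occ ν) : 0 ≤ boxWeight ν L Δ lam β μ n :=
  (meanFieldWeight_pos _ _ n).le

lemma tsum_boxWeight_pos {L Δ lam β μ : ℝ} (hL : 0 < L) (hlam : 0 < lam) (hβ : 0 < β) :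
    0 < ∑' n, boxWeight ν L Δ lam β μ n :=
  (summable_boxWeight hL hlam hβ).tsum_pos (boxWeight_nonneg L Δ lam β μ) 0
    (meanFieldWeight_pos _ _ 0)

lemma boxWeight_zero (L β a : ℝ) :
    boxWeight ν L 0 0 β a = boltzmann (referenceEnergy ν L β a (-a)) := by
  have h : reducedEnergy ν L 0 β a = referenceEnergy ν L β a (-a) := by
    funext k
    unfold reducedEnergy referenceEnergy
    split_ifs with hk
    · subst hk; rw [modeEnergy_zero]; ring
    · ring
  funext n
  rw [boxWeight, h, meanFieldWeight, boltzmann]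
  simp

/-- The mean particle density. -/
def meanDensity (ν : ℕ) (Δ lam β μ L : ℝ) : ℝ :=
  mean (boxWeight ν L Δ lam β μ) particles / L ^ ν

/-- The mean density of the zero mode. -/
def meanZeroDensity (ν : ℕ) (Δ lam β μ L : ℝ) : ℝ :=
  mean (boxWeight ν L Δ lam β μ) (fun n => (n 0 : ℝ)) / L ^ ν

/-- The mean of the squared particle density. -/
def meanSqDensity (ν : ℕ) (Δ lam β μ L : ℝ) : ℝ :=
  mean (boxWeight ν L Δ lam β μ) (fun n => particles n ^ 2) / (L ^ ν) ^ 2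

lemma meanZeroDensity_nonneg {Δ lam β μ L : ℝ} (hL : 0 < L) :
    0 ≤ meanZeroDensity ν Δ lam β μ L :=
  div_nonneg (div_nonneg (tsum_nonneg fun n => mul_nonneg (Nat.cast_nonneg _)
    (boxWeight_nonneg _ _ _ _ _ n)) (tsum_nonneg (boxWeight_nonneg _ _ _ _ _))) (by positivity)

lemma meanZeroDensity_le {Δ lam β μ L : ℝ} (hL : 0 < L) (hlam : 0 < lam) (hβ : 0 < β) :
    meanZeroDensity ν Δ lam β μ L ≤ meanDensity ν Δ lam β μ L :=
  div_le_div_of_nonneg_right (mean_mono (boxWeight_nonneg _ _ _ _ _)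
    (summable_mul_boxWeight hL hlam hβ (abs_occupation_le 0))
    (summable_mul_boxWeight hL hlam hβ abs_particles_le) fun n => le_particles n 0)
    (by positivity)

lemma meanDensity_sq_le {Δ lam β μ L : ℝ} (hL : 0 < L) (hlam : 0 < lam) (hβ : 0 < β) :
    meanDensity ν Δ lam β μ L ^ 2 ≤ meanSqDensity ν Δ lam β μ L := by
  rw [meanDensity, meanSqDensity, div_pow]
  refine div_le_div_of_nonneg_right ?_ (by positivity)
  set w := boxWeight ν L Δ lam β μ
  set c := mean w particles with hc
  have h1 : Summable fun n => (2 * c * particles n) * w n := by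
    simpa only [mul_assoc] using
      (summable_mul_boxWeight hL hlam hβ abs_particles_le).mul_left (2 * c)
  have h2 : Summable fun n => (-c ^ 2 * 1) * w n := by
    simpa only [mul_one] using (summable_boxWeight hL hlam hβ).mul_left (-c ^ 2)
  have h3 := mean_mono (boxWeight_nonneg L Δ lam β μ)
    (by simpa only [add_mul] using h1.add h2)
    (summable_mul_boxWeight hL hlam hβ abs_particles_sq_le)
    (fun n : Occ ν => show 2 * c * particles n + -c ^ 2 * 1 ≤ particles n ^ 2 by
      nlinarith [sq_nonneg (particles n - c)])
  rw [mean_add h1 h2, mean_const_mul, mean_const_mul, mean_one (tsum_boxWeight_pos hL hlam hβ),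
    ← hc] at h3
  linarith

lemma IsFreeGas.mean_sq_add_le {ι : Type*} {η : ι → ℝ} (h : IsFreeGas η) {s : ℝ} (hs : 0 < s)
    (hη : ∀ k, s ≤ η k) (M : ℕ) :
    mean (boltzmann η) (fun n => (particles n + M) ^ 2) ≤
      (∑' k, bose (η k) + M) ^ 2 + (bose s + 1) * ∑' k, bose (η k) := by
  have h1 : mean (boltzmann η) (fun n => (particles n + M) ^ 2) =
      mean (boltzmann η) (fun n => particles n ^ 2) +
        (2 * M * mean (boltzmann η) particles + M ^ 2 * 1) := by
    rw [← mean_one h.tsum_pos, ← mean_const_mul, ← mean_const_mul]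
    have hp : Summable fun n => (2 * M * particles n) * boltzmann η n := by
      simpa only [mul_assoc] using (h.summable_mul abs_particles_le).mul_left (2 * (M : ℝ))
    have hq : Summable fun n => ((M : ℝ) ^ 2 * 1) * boltzmann η n := by
      simpa only [mul_one] using h.summable_boltzmann.mul_left ((M : ℝ) ^ 2)
    rw [← BoseGas.mean_add hp hq, ← BoseGas.mean_add (h.summable_mul abs_particles_sq_le)
      (by simpa only [add_mul] using hp.add hq)]
    congr 1
    funext n
    ring
  have h2 := hasSum_le (fun k => show bose (η k) * (bose (η k) + 1) ≤
      (bose s + 1) * bose (η k) by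
    have := bose_pos (h.pos k)
    nlinarith [bose_antitone hs (hη k)]) h.hasSum_variance
    (h.summable_bose.hasSum.mul_left (bose s + 1))
  rw [h1, h.mean_particles]
  nlinarith

/-- The variational inequality per volume, in the limit of a large box: the free energy of the
trial state with density `ρ(a)` of thermal particles and density `m` of condensed ones bounds that
of the mean-field gas. -/
theorem eventually_variational_le {Δ lam β μ a t m C : ℝ} (hlam : 0 < lam) (hβ : 0 < β)
    (ha : a < 0) (ht : 0 < t) (hm : 0 ≤ m) (hν : 1 ≤ ν)
    (hC : lam / 2 * (perfectDensity ν β a + m) ^ 2 + (a - μ) * perfectDensity ν β a -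
      m * (Δ + μ) < C) :
    ∀ᶠ L : ℝ in atTop, lam / 2 * meanSqDensity ν Δ lam β μ L +
      (a - μ) * meanDensity ν Δ lam β μ L - (Δ + t + a) * meanZeroDensity ν Δ lam β μ L ≤ C := by
  set s := min (β * t) (β * -a) with hs_def
  have hs : 0 < s := lt_min (by positivity) (by nlinarith)
  have hV : Tendsto (fun L : ℝ => L ^ ν) atTop atTop := tendsto_pow_atTop (by omega)
  have hVinv : Tendsto (fun L : ℝ => (L ^ ν)⁻¹) atTop (𝓝 0) := hV.inv_tendsto_atTop
  set r : ℝ → ℝ := fun L => (∑' k, bose (referenceEnergy ν L β a t k)) / L ^ ν with hr_def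
  have hr : Tendsto r atTop (𝓝 (perfectDensity ν β a)) := by
    have h1 := (hVinv.const_mul (bose (β * t) - bose (β * -a))).add
      (tendsto_tsum_bose (ν := ν) hβ ha)
    rw [mul_zero, zero_add] at h1
    refine h1.congr' ?_
    filter_upwards [eventually_gt_atTop 0] with L hL
    rw [hr_def]
    simp only
    rw [(hasSum_bose_referenceEnergy t hβ ha hL).tsum_eq]
    ring
  set q : ℝ → ℝ := fun L => (⌊m * L ^ ν⌋₊ : ℝ) / L ^ ν with hq_def
  have hq : Tendsto q atTop (𝓝 m) := (tendsto_nat_floor_mul_div_atTop hm).comp hV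
  have hlim : Tendsto (fun L : ℝ => lam / 2 * ((r L + q L) ^ 2 +
      (bose s + 1) * r L * (L ^ ν)⁻¹) + (a - μ) * r L -
        (Δ + t + a) * bose (β * t) * (L ^ ν)⁻¹ - q L * (Δ + μ)) atTop
      (𝓝 (lam / 2 * ((perfectDensity ν β a + m) ^ 2 +
        (bose s + 1) * perfectDensity ν β a * 0) + (a - μ) * perfectDensity ν β a -
        (Δ + t + a) * bose (β * t) * 0 - m * (Δ + μ))) :=
    (((((((hr.add hq).pow 2).add ((hr.const_mul _).mul hVinv)).const_mul _).add
      (hr.const_mul _)).sub (hVinv.const_mul _)).sub (hq.mul_const _))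
  have hlt := hlim.eventually_lt_const (u := C) (by linarith)
  filter_upwards [hlt, eventually_gt_atTop 0] with L hLC hL
  refine le_trans ?_ hLC.le
  have hη := isFreeGas_referenceEnergy (ν := ν) hβ ha ht hL
  have hVpos : 0 < L ^ ν := by positivity
  have key := mean_field_le hη (κ := β * lam / (2 * L ^ ν)) (by positivity)
    (abs_reducedEnergy_sub_le L Δ β μ a t) 0 ⌊m * L ^ ν⌋₊
  have hsq := hη.mean_sq_add_le hs (min_le_referenceEnergy hβ) ⌊m * L ^ ν⌋₊
  have hadd : (additive fun k => reducedEnergy ν L Δ β μ k - referenceEnergy ν L β a t k) =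
      fun n => β * (a - μ) * particles n + (-(β * (Δ + t + a))) * (n 0 : ℝ) := by
    funext n
    rw [reducedEnergy_sub, additive_ite]; ring
  have hp : Summable fun n => (β * (a - μ) * particles n) * boltzmann
      (referenceEnergy ν L β a t) n := by
    simpa only [mul_assoc] using (hη.summable_mul abs_particles_le).mul_left (β * (a - μ))
  have hp0 : Summable fun n : Occ ν => (-(β * (Δ + t + a)) * (n 0 : ℝ)) * boltzmann
      (referenceEnergy ν L β a t) n := by
    simpa only [mul_assoc] using
      (hη.summable_mul (abs_occupation_le 0)).mul_left (-(β * (Δ + t + a)))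
  have hW : Summable fun n => (β * (a - μ) * particles n) * boxWeight ν L Δ lam β μ n := by
    simpa only [mul_assoc] using
      (summable_mul_boxWeight hL hlam hβ abs_particles_le).mul_left (β * (a - μ))
  have hW0 : Summable fun n : Occ ν => (-(β * (Δ + t + a)) * (n 0 : ℝ)) *
      boxWeight ν L Δ lam β μ n := by
    simpa only [mul_assoc] using
      (summable_mul_boxWeight hL hlam hβ (abs_occupation_le 0)).mul_left (-(β * (Δ + t + a)))
  have he0 : reducedEnergy ν L Δ β μ 0 = -(β * (Δ + μ)) := by
    simp only [reducedEnergy, modeEnergy_zero, if_true]; ring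
  have hη0 : referenceEnergy ν L β a t 0 = β * t := if_pos rfl
  change _ * mean (boxWeight ν L Δ lam β μ) _ + mean (boxWeight ν L Δ lam β μ) _ ≤ _ at key
  rw [hadd, mean_add hW hW0, mean_add hp hp0, mean_const_mul, mean_const_mul, mean_const_mul,
    mean_const_mul, he0, hη.mean_particles, hη.mean_occupation, hη0] at key
  rw [meanSqDensity, meanDensity, meanZeroDensity]
  simp only [hr_def, hq_def]
  set A := mean (boxWeight ν L Δ lam β μ) (fun n => particles n ^ 2)
  set B := mean (boxWeight ν L Δ lam β μ) particles
  set E := mean (boxWeight ν L Δ lam β μ) (fun n => (n 0 : ℝ))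
  set S := ∑' k, bose (referenceEnergy ν L β a t k)
  set M : ℝ := (⌊m * L ^ ν⌋₊ : ℝ)
  set V := L ^ ν
  have key2 : β * lam / (2 * V) * A + (β * (a - μ) * B + -(β * (Δ + t + a)) * E) ≤
      β * lam / (2 * V) * ((S + M) ^ 2 + (bose s + 1) * S) +
        (β * (a - μ) * S + -(β * (Δ + t + a)) * bose (β * t)) + M * -(β * (Δ + μ)) := by
    have := mul_le_mul_of_nonneg_left hsq (show 0 ≤ β * lam / (2 * V) by positivity)
    linarith
  have key3 := mul_le_mul_of_nonneg_left key2 (show 0 ≤ (β * V)⁻¹ by positivity)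
  refine (le_of_eq ?_).trans (key3.trans (le_of_eq ?_))
  · field_simp; ring
  · field_simp; ring

end Box

/-! ### From the variational inequalities to the limits -/

section Limits

/-- The information about a mean-field gas that determines its thermodynamic limit: along the
filter `l`, the mean density `n`, the mean zero-mode density `n₀` and the mean squared density `s`
satisfy the variational inequalities, in which `ρ` is the density of the perfect gas as a function
of the chemical potential. -/
structure IsVariational {α : Type*} (l : Filter α) (lam Δ μ : ℝ) (ρ : ℝ → ℝ) (s n n₀ : α → ℝ) :
    Prop where
  lam_pos : 0 < lam
  gap_nonneg : 0 ≤ Δ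
  density_nonneg : ∀ a < 0, 0 ≤ ρ a
  density_mono : ∀ a b, a ≤ b → b < 0 → ρ a ≤ ρ b
  density_continuousAt : ∀ a < 0, ContinuousAt ρ a
  zero_nonneg : ∀ᶠ L in l, 0 ≤ n₀ L
  zero_le : ∀ᶠ L in l, n₀ L ≤ n L
  sq_le : ∀ᶠ L in l, n L ^ 2 ≤ s L
  le : ∀ a t m C, a < 0 → 0 < t → 0 ≤ m →
    lam / 2 * (ρ a + m) ^ 2 + (a - μ) * ρ a - m * (Δ + μ) < C →
    ∀ᶠ L in l, lam / 2 * s L + (a - μ) * n L - (Δ + t + a) * n₀ L ≤ C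

namespace IsVariational

variable {α : Type*} {l : Filter α} {lam Δ μ : ℝ} {ρ : ℝ → ℝ} {s n n₀ : α → ℝ}

/-- If the mean square deviation of the density from `x` is asymptotically at most any `ε > 0`,
then the density concentrates at `x`. -/
lemma tendsto_of_deviation (h : IsVariational l lam Δ μ ρ s n n₀) {x : ℝ}
    (hx : ∀ ε > 0, ∀ᶠ L in l, s L - 2 * x * n L + x ^ 2 ≤ ε) :
    Tendsto n l (𝓝 x) ∧ Tendsto s l (𝓝 (x ^ 2)) := by
  have hn : Tendsto n l (𝓝 x) := by
    rw [Metric.tendsto_nhds]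
    intro ε hε
    filter_upwards [hx (ε ^ 2 / 2) (by positivity), h.sq_le] with L h1 h2
    rw [Real.dist_eq]
    refine abs_lt_of_sq_lt_sq ?_ hε.le
    nlinarith [sq_pos_of_pos hε]
  have hdev : Tendsto (fun L => s L - 2 * x * n L + x ^ 2) l (𝓝 0) := by
    rw [Metric.tendsto_nhds]
    intro ε hε
    filter_upwards [hx (ε / 2) (by positivity), h.sq_le] with L h1 h2
    rw [Real.dist_eq, sub_zero, abs_lt]
    constructor <;> nlinarith [sq_nonneg (n L - x)]
  refine ⟨hn, ?_⟩
  have h3 := (hdev.add (hn.const_mul (2 * x))).sub_const (x ^ 2)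
  have h4 : (0 : ℝ) + 2 * x * x - x ^ 2 = x ^ 2 := by ring
  rw [h4] at h3
  refine h3.congr fun L => ?_
  ring

/-- Below the threshold the gas is the perfect gas at a self-consistent chemical potential
`a = μ - lam ρ(a)`. -/
lemma tendsto_of_root (h : IsVariational l lam Δ μ ρ s n n₀) {a : ℝ} (ha : a < -Δ)
    (hroot : lam * ρ a = μ - a) :
    Tendsto n l (𝓝 (ρ a)) ∧ Tendsto s l (𝓝 (ρ a ^ 2)) := by
  refine h.tendsto_of_deviation fun ε hε => ?_
  have hlam := h.lam_pos
  have hμ : μ = lam * ρ a + a := by linarith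
  filter_upwards [h.le a (-Δ - a) 0 (-(lam / 2 * ρ a ^ 2) + lam / 2 * ε)
    (by linarith [h.gap_nonneg]) (by linarith) le_rfl
    (by rw [hμ]; nlinarith [mul_pos hlam hε])] with L hL
  rw [hμ] at hL
  have h1 : lam / 2 * (s L - 2 * ρ a * n L + ρ a ^ 2) ≤ lam / 2 * ε := by
    linear_combination hL
  exact le_of_mul_le_mul_left h1 (by positivity)

/-- Below the threshold the zero mode can be given a chemical potential strictly between the
self-consistent one and its energy `-Δ` at no cost, so that it is not macroscopically occupied. -/
lemma tendsto_zero_of_root (h : IsVariational l lam Δ μ ρ s n n₀) {a : ℝ} (ha : a < -Δ)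
    (hroot : lam * ρ a = μ - a) : Tendsto n₀ l (𝓝 0) := by
  have hlam := h.lam_pos
  have hμ : μ = lam * ρ a + a := by linarith
  rw [Metric.tendsto_nhds]
  intro ε hε
  set t := (-Δ - a) / 2 with ht_def
  have ht : 0 < t := by rw [ht_def]; linarith
  filter_upwards [h.le a t 0 (-(lam / 2 * ρ a ^ 2) + t * (ε / 2))
    (by linarith [h.gap_nonneg]) ht le_rfl
    (by rw [hμ]; nlinarith [mul_pos ht hε]), h.zero_nonneg, h.sq_le] with L hL h0 hsq
  rw [Real.dist_eq, sub_zero, abs_of_nonneg h0]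
  have hΔ : Δ + t + a = -t := by rw [ht_def]; ring
  rw [hΔ, hμ] at hL
  have h1 : 0 ≤ lam / 2 * (s L - 2 * ρ a * n L + ρ a ^ 2) :=
    mul_nonneg (by positivity) (by nlinarith [sq_nonneg (n L - ρ a)])
  have h2 : t * n₀ L ≤ t * (ε / 2) := by nlinarith
  linarith [le_of_mul_le_mul_left h2 ht]

lemma threshold_nonneg (h : IsVariational l lam Δ μ ρ s n n₀)
    (hsup : ∀ a < -Δ, lam * ρ a ≤ μ - a) : 0 ≤ μ + Δ := by
  by_contra! hneg
  have h1 := hsup (-Δ + (μ + Δ) / 2) (by linarith)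
  have h2 := mul_nonneg h.lam_pos.le
    (h.density_nonneg (-Δ + (μ + Δ) / 2) (by linarith [h.gap_nonneg]))
  linarith

/-- Above the threshold, trial states with chemical potential just below `-Δ` and the missing
density in the zero mode show that the density is `(μ + Δ) / lam`. -/
lemma tendsto_of_supercritical (h : IsVariational l lam Δ μ ρ s n n₀)
    (hsup : ∀ a < -Δ, lam * ρ a ≤ μ - a) :
    Tendsto n l (𝓝 ((μ + Δ) / lam)) ∧ Tendsto s l (𝓝 (((μ + Δ) / lam) ^ 2)) := by
  have hlam := h.lam_pos
  set x := (μ + Δ) / lam with hx_def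
  have hx : lam * x = μ + Δ := by rw [hx_def]; field_simp
  have hx0 : 0 ≤ x := div_nonneg (h.threshold_nonneg hsup) hlam.le
  refine h.tendsto_of_deviation fun ε hε => ?_
  have hF : Tendsto (fun δ : ℝ => 2 / lam * δ * (x + δ / lam + 1) +
      2 * (δ / lam) * (2 / lam * δ * (x + δ / lam + 1) + 1 + (x + δ / lam)))
      (𝓝[>] 0) (𝓝 0) := by
    refine tendsto_nhdsWithin_of_tendsto_nhds ?_
    refine Continuous.tendsto' (by fun_prop) _ _ (by simp)
  obtain ⟨δ, hδε, hδ⟩ := ((hF.eventually_lt_const hε).and self_mem_nhdsWithin).exists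
  have hδ0 : 0 < δ := hδ
  set X := x + δ / lam with hX_def
  have hX : lam * X = μ + Δ + δ := by rw [hX_def, mul_add, hx]; field_simp
  have hxX : x ≤ X := by rw [hX_def]; linarith [div_pos hδ0 hlam]
  set a := -Δ - δ with ha_def
  have ha : a < 0 := by linarith [h.gap_nonneg]
  have hρ := h.density_nonneg a ha
  have hm : 0 ≤ X - ρ a := by
    have : lam * ρ a ≤ lam * X := (hsup a (by linarith)).trans (by linarith)
    linarith [le_of_mul_le_mul_left this hlam]
  have hμ : μ = lam * X - Δ - δ := by linarith
  filter_upwards [h.le a (-Δ - a) (X - ρ a) (-(lam / 2 * X ^ 2) + δ * (X + 1)) ha (by linarith) hm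
    (by
      have h1 : lam / 2 * (ρ a + (X - ρ a)) ^ 2 + (a - μ) * ρ a - (X - ρ a) * (Δ + μ) =
          -(lam / 2 * X ^ 2) + δ * (X - ρ a) := by rw [hμ, ha_def]; ring
      rw [h1]; nlinarith [mul_nonneg hδ0.le hρ]), h.sq_le] with L hL hsq
  set b := 2 / lam * δ * (X + 1) with hb_def
  have h1 : s L - 2 * X * n L + X ^ 2 ≤ b := by
    have h2 : lam / 2 * (s L - 2 * X * n L + X ^ 2) ≤ lam / 2 * b := by
      have h3 : lam / 2 * b = δ * (X + 1) := by rw [hb_def]; field_simp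
      rw [hμ, ha_def] at hL
      rw [h3]
      linear_combination hL
    exact le_of_mul_le_mul_left h2 (by positivity)
  have h2 : n L ≤ b + 1 + X := by nlinarith [sq_nonneg (n L - X - 1), sq_nonneg (n L - X)]
  have h3 : X - x = δ / lam := by rw [hX_def]; ring
  have h4 : s L - 2 * x * n L + x ^ 2 =
      (s L - 2 * X * n L + X ^ 2) + 2 * (δ / lam) * n L - (X ^ 2 - x ^ 2) := by
    rw [← h3]; ring
  have h5 : 2 * (δ / lam) * n L ≤ 2 * (δ / lam) * (b + 1 + X) :=
    mul_le_mul_of_nonneg_left h2 (by positivity)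
  have h6 : 0 ≤ X ^ 2 - x ^ 2 := by nlinarith
  linarith

/-- Comparison with thermal particles at a chemical potential `a` different from `-Δ` controls
their density from above (`a > -Δ`) and from below (`a < -Δ`). -/
lemma eventually_thermal_le (h : IsVariational l lam Δ μ ρ s n n₀)
    (hn : Tendsto n l (𝓝 ((μ + Δ) / lam))) {a δ : ℝ} (ha : a < 0) (hρ : lam * ρ a ≤ μ + Δ)
    (hδ : 0 < δ) : ∀ᶠ L in l, (a + Δ) * (n L - n₀ L - ρ a) ≤ δ := by
  have hlam := h.lam_pos
  set x := (μ + Δ) / lam with hx_def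
  have hx : lam * x = μ + Δ := by rw [hx_def]; field_simp
  have hm : 0 ≤ x - ρ a := by
    rw [← hx] at hρ
    linarith [le_of_mul_le_mul_left hρ hlam]
  have hx0 : 0 ≤ x := by linarith [h.density_nonneg a ha]
  have hμ : μ = lam * x - Δ := by linarith
  set t := δ / 2 / (x + 1) with ht_def
  have ht : 0 < t := by positivity
  filter_upwards [h.le a t (x - ρ a) (-(lam / 2 * x ^ 2) + (a + Δ) * ρ a + δ / 2) ha ht hm
    (by
      have h1 : lam / 2 * (ρ a + (x - ρ a)) ^ 2 + (a - μ) * ρ a - (x - ρ a) * (Δ + μ) =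
          -(lam / 2 * x ^ 2) + (a + Δ) * ρ a := by rw [hμ]; ring
      rw [h1]; linarith), h.sq_le, h.zero_le,
    hn.eventually_lt_const (show x < x + 1 by linarith)] with L hL hsq hle hlt
  have h1 : 0 ≤ lam / 2 * (s L - 2 * x * n L + x ^ 2) :=
    mul_nonneg (by positivity) (by nlinarith [sq_nonneg (n L - x)])
  have h2 : t * n₀ L ≤ δ / 2 := by
    have h3 : t * (x + 1) = δ / 2 := by rw [ht_def]; field_simp
    rw [← h3]
    exact mul_le_mul_of_nonneg_left (by linarith) ht.le
  rw [hμ] at hL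
  linear_combination hL + h1 + h2

/-- At and above the threshold the thermal particles saturate at the density `ρ(-Δ)`, and the
remaining particles are in the zero mode. -/
lemma tendsto_zero_of_supercritical (h : IsVariational l lam Δ μ ρ s n n₀) (hΔ : 0 < Δ)
    (hsup : lam * ρ (-Δ) ≤ μ + Δ) (hn : Tendsto n l (𝓝 ((μ + Δ) / lam))) :
    Tendsto n₀ l (𝓝 ((μ + Δ) / lam - ρ (-Δ))) := by
  have hlam := h.lam_pos
  have hcont := h.density_continuousAt (-Δ) (by linarith)
  suffices hth : Tendsto (fun L => n L - n₀ L) l (𝓝 (ρ (-Δ))) by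
    refine (hn.sub hth).congr fun L => ?_
    ring
  refine tendsto_order.2 ⟨fun c hc => ?_, fun c hc => ?_⟩
  · have h1 : ∀ᶠ a in 𝓝[<] (-Δ), c < ρ a :=
      (hcont.tendsto.mono_left nhdsWithin_le_nhds).eventually_const_lt hc
    obtain ⟨a, hca, ha⟩ := (h1.and self_mem_nhdsWithin).exists
    have ha' : a < -Δ := ha
    have hmono := h.density_mono a (-Δ) ha'.le (by linarith)
    have hρ : lam * ρ a ≤ μ + Δ := by nlinarith
    have hpos : 0 < (-Δ - a) * ((ρ a - c) / 2) := mul_pos (by linarith) (by linarith)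
    filter_upwards [h.eventually_thermal_le hn (by linarith) hρ hpos] with L hL
    have h2 : (-Δ - a) * (ρ a - (n L - n₀ L)) ≤ (-Δ - a) * ((ρ a - c) / 2) := by
      linear_combination hL
    linarith [le_of_mul_le_mul_left h2 (by linarith)]
  · rcases hsup.lt_or_eq with hlt | heq
    · have h1 : ∀ᶠ a in 𝓝[>] (-Δ), ρ a < c :=
        (hcont.tendsto.mono_left nhdsWithin_le_nhds).eventually_lt_const hc
      have h2 : ∀ᶠ a in 𝓝[>] (-Δ), lam * ρ a < μ + Δ :=
        ((hcont.tendsto.const_mul lam).mono_left nhdsWithin_le_nhds).eventually_lt_const hlt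
      have h3 : ∀ᶠ a in 𝓝[>] (-Δ), a < 0 :=
        nhdsWithin_le_nhds (Iio_mem_nhds (by linarith))
      obtain ⟨a, ⟨⟨hca, hρ⟩, ha0⟩, ha⟩ := (((h1.and h2).and h3).and self_mem_nhdsWithin).exists
      have ha' : -Δ < a := ha
      have hpos : 0 < (a + Δ) * ((c - ρ a) / 2) := mul_pos (by linarith) (by linarith)
      filter_upwards [h.eventually_thermal_le hn ha0 hρ.le hpos] with L hL
      linarith [le_of_mul_le_mul_left hL (by linarith)]
    · -- exactly at the threshold the total density already is `ρ(-Δ)`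
      have h1 : (μ + Δ) / lam = ρ (-Δ) := by rw [← heq]; field_simp
      rw [h1] at hn
      filter_upwards [hn.eventually_lt_const hc, h.zero_nonneg] with L hL h0
      linarith

/-- If `lam ρ(b)` is at least `μ - b`, the self-consistent equation `lam ρ(a) = μ - a` has a root
`a ≤ b`. -/
lemma exists_root (h : IsVariational l lam Δ μ ρ s n n₀) {b : ℝ} (hb : b < 0)
    (hsub : μ - b ≤ lam * ρ b) : ∃ a ≤ b, lam * ρ a = μ - a := by
  have hlam := h.lam_pos
  set a₁ := min b (μ - lam * ρ b) with ha₁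
  have h1 : a₁ ≤ b := min_le_left _ _
  have h2 : a₁ ≤ μ - lam * ρ b := min_le_right _ _
  have hcont : ContinuousOn (fun a => lam * ρ a + a) (Set.Icc a₁ b) := fun a ha =>
    (((h.density_continuousAt a (ha.2.trans_lt hb)).const_mul lam).add
      continuousAt_id).continuousWithinAt
  have hmono := mul_le_mul_of_nonneg_left (h.density_mono a₁ b h1 hb) hlam.le
  obtain ⟨a, ha, hroot⟩ := intermediate_value_Icc h1 hcont
    (show μ ∈ Set.Icc _ _ from ⟨by linarith, by linarith⟩)
  exact ⟨a, ha.2, by simp only at hroot; linarith⟩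

/-- The limiting density exists for every chemical potential: either the self-consistent equation
has a root below `-Δ`, or the gas is saturated. -/
lemma exists_tendsto (h : IsVariational l lam Δ μ ρ s n n₀) :
    ∃ ρ₀, Tendsto n l (𝓝 ρ₀) := by
  by_cases hsup : ∀ a < -Δ, lam * ρ a ≤ μ - a
  · exact ⟨_, (h.tendsto_of_supercritical hsup).1⟩
  · push Not at hsup
    obtain ⟨b, hb, hlt⟩ := hsup
    obtain ⟨a, ha, hroot⟩ := h.exists_root (by linarith [h.gap_nonneg]) hlt.le
    exact ⟨_, (h.tendsto_of_root (by linarith) hroot).1⟩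

end IsVariational

lemma isVariational_box {ν : ℕ} (hν : 1 ≤ ν) {β lam Δ : ℝ} (μ : ℝ) (hβ : 0 < β) (hlam : 0 < lam)
    (hΔ : 0 ≤ Δ) :
    IsVariational atTop lam Δ μ (perfectDensity ν β) (meanSqDensity ν Δ lam β μ)
      (meanDensity ν Δ lam β μ) (meanZeroDensity ν Δ lam β μ) where
  lam_pos := hlam
  gap_nonneg := hΔ
  density_nonneg _ ha := perfectDensity_nonneg hβ ha
  density_mono _ _ hab hb := perfectDensity_mono hβ hab hb
  density_continuousAt _ ha := continuousAt_perfectDensity hβ ha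
  zero_nonneg := (eventually_gt_atTop 0).mono fun _ hL => meanZeroDensity_nonneg hL
  zero_le := (eventually_gt_atTop 0).mono fun _ hL => meanZeroDensity_le hL hlam hβ
  sq_le := (eventually_gt_atTop 0).mono fun _ hL => meanDensity_sq_le hL hlam hβ
  le _ _ _ _ ha ht hm hC := eventually_variational_le hlam hβ ha ht hm hν hC

/-- The limits of the gas with gap, on both sides of the threshold, in terms of the limiting
density of the gapless gas. -/
theorem exists_limits {ν : ℕ} (hν : 1 ≤ ν) {β lam Δ : ℝ} (μ : ℝ) (hβ : 0 < β) (hlam : 0 < lam)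
    (hΔ : 0 < Δ) :
    ∃ ρ₀ : ℝ, Tendsto (meanDensity ν 0 lam β μ) atTop (𝓝 ρ₀) ∧
      Tendsto (meanDensity ν Δ lam β μ) atTop
        (𝓝 (if μ ≤ -Δ + lam * perfectDensity ν β (-Δ) then ρ₀ else (μ + Δ) / lam)) ∧
      Tendsto (meanZeroDensity ν Δ lam β μ) atTop
        (𝓝 (if μ ≤ -Δ + lam * perfectDensity ν β (-Δ) then 0
          else (μ + Δ) / lam - perfectDensity ν β (-Δ))) ∧
      Tendsto (meanSqDensity ν Δ lam β μ) atTop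
        (𝓝 (if μ ≤ -Δ + lam * perfectDensity ν β (-Δ) then ρ₀ ^ 2
          else (μ + Δ) ^ 2 / lam ^ 2)) := by
  have h := isVariational_box hν μ hβ hlam hΔ.le
  have h₀ := isVariational_box hν μ hβ hlam le_rfl
  set ρ := perfectDensity ν β
  have hmono : ∀ a < -Δ, lam * ρ a ≤ lam * ρ (-Δ) := fun a ha =>
    mul_le_mul_of_nonneg_left (h.density_mono a (-Δ) ha.le (by linarith)) hlam.le
  by_cases hthr : μ ≤ -Δ + lam * ρ (-Δ)
  · simp only [if_pos hthr]
    obtain ⟨a, ha, hroot⟩ := h₀.exists_root (b := -Δ) (by linarith) (by linarith)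
    refine ⟨ρ a, (h₀.tendsto_of_root (by linarith) hroot).1, ?_⟩
    rcases ha.lt_or_eq with hlt | rfl
    · exact ⟨(h.tendsto_of_root hlt hroot).1, h.tendsto_zero_of_root hlt hroot,
        (h.tendsto_of_root hlt hroot).2⟩
    · have hx : (μ + Δ) / lam = ρ (-Δ) := by
        rw [div_eq_iff hlam.ne']; linarith
      obtain ⟨hn, hs⟩ := h.tendsto_of_supercritical fun a ha => by linarith [hmono a ha]
      have hz := h.tendsto_zero_of_supercritical hΔ (by linarith) hn
      rw [hx] at hn hs hz
      rw [sub_self] at hz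
      exact ⟨hn, hz, hs⟩
  · simp only [if_neg hthr]
    push Not at hthr
    obtain ⟨ρ₀, hρ₀⟩ := h₀.exists_tendsto
    obtain ⟨hn, hs⟩ := h.tendsto_of_supercritical fun a ha => by linarith [hmono a ha]
    rw [div_pow] at hs
    exact ⟨ρ₀, hρ₀, hn, h.tendsto_zero_of_supercritical hΔ (by linarith) hn, hs⟩

end Limits

end BoseGas

end

theorem theorem3 (ν : ℕ) (hν : 1 ≤ ν) (β lam Δ μ : ℝ) (hβ : 0 < β) (hlam : 0 < lam)
    (hΔ : 0 < Δ) :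
    -- the Gibbs expectations below exist in every box
    (∀ L : ℝ, 0 < L →
      BoseGas.GibbsDefined ν L Δ lam β μ (BoseGas.totalNumber ν) ∧
      BoseGas.GibbsDefined ν L Δ lam β μ (BoseGas.modeNumber 0) ∧
      BoseGas.GibbsDefined ν L Δ lam β μ (BoseGas.totalNumber ν ^ 2) ∧
      BoseGas.GibbsDefined ν L 0 lam β μ (BoseGas.totalNumber ν) ∧
      BoseGas.GibbsDefined ν L 0 0 β (-Δ) (BoseGas.totalNumber ν)) ∧
    -- `perfectDensity` is the limiting density of the perfect gas (no gap, no interaction)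
    MeasureTheory.Integrable (fun k : EuclideanSpace ℝ (Fin ν) =>
      (Real.exp (β * (‖k‖ ^ 2 - (-Δ))) - 1)⁻¹) ∧
    Tendsto (fun L : ℝ =>
        BoseGas.gibbsMean ν L 0 0 β (-Δ) (BoseGas.totalNumber ν) / ((L ^ ν : ℝ) : ℂ))
      atTop (𝓝 ((BoseGas.perfectDensity ν β (-Δ) : ℝ) : ℂ)) ∧
    -- `ρ₀` is the limiting density of the mean-field gas without gap
    ∃ ρ₀ : ℝ,
      Tendsto (fun L : ℝ =>
          BoseGas.gibbsMean ν L 0 lam β μ (BoseGas.totalNumber ν) / ((L ^ ν : ℝ) : ℂ))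
        atTop (𝓝 (ρ₀ : ℂ)) ∧
      Tendsto (fun L : ℝ =>
          BoseGas.gibbsMean ν L Δ lam β μ (BoseGas.totalNumber ν) / ((L ^ ν : ℝ) : ℂ))
        atTop (𝓝 ((if μ ≤ -Δ + lam * BoseGas.perfectDensity ν β (-Δ) then ρ₀
          else (μ + Δ) / lam : ℝ) : ℂ)) ∧
      Tendsto (fun L : ℝ =>
          BoseGas.gibbsMean ν L Δ lam β μ (BoseGas.modeNumber 0) / ((L ^ ν : ℝ) : ℂ))
        atTop (𝓝 ((if μ ≤ -Δ + lam * BoseGas.perfectDensity ν β (-Δ) then 0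
          else (μ + Δ) / lam - BoseGas.perfectDensity ν β (-Δ) : ℝ) : ℂ)) ∧
      Tendsto (fun L : ℝ =>
          BoseGas.gibbsMean ν L Δ lam β μ (BoseGas.totalNumber ν ^ 2)
            / (((L ^ ν : ℝ) : ℂ) ^ 2))
        atTop (𝓝 ((if μ ≤ -Δ + lam * BoseGas.perfectDensity ν β (-Δ) then ρ₀ ^ 2
          else (μ + Δ) ^ 2 / lam ^ 2 : ℝ) : ℂ)) := by
  have hG : ∀ {L Δ' μ' : ℝ}, 0 < L → ∀ {B : Module.End ℂ (BoseGas.Core ν)}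
      {b : BoseGas.Occ ν → ℝ} {C : ℝ}, (∀ n, B (BoseGas.ket n) = (b n : ℂ) • BoseGas.ket n) →
      (∀ n, |b n| ≤ C * (1 + BoseGas.particles n) ^ 2) →
      BoseGas.GibbsDefined ν L Δ' lam β μ' B := fun hL _ _ _ hB hb =>
    BoseGas.gibbsDefined_of_summable hB (BoseGas.summable_boxWeight hL hlam hβ)
      (BoseGas.summable_mul_boxWeight hL hlam hβ hb)
  have hfree : ∀ {L : ℝ}, 0 < L → BoseGas.IsFreeGas (BoseGas.referenceEnergy ν L β (-Δ) (- -Δ)) :=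
    fun hL => BoseGas.isFreeGas_referenceEnergy hβ (by linarith) (by linarith) hL
  refine ⟨fun L hL => ⟨hG hL BoseGas.totalNumber_ket BoseGas.abs_particles_le,
    hG hL (b := fun n => (n 0 : ℝ)) (fun n => by simp [BoseGas.modeNumber_ket])
      (BoseGas.abs_occupation_le 0),
    hG hL BoseGas.totalNumber_sq_ket BoseGas.abs_particles_sq_le,
    hG hL BoseGas.totalNumber_ket BoseGas.abs_particles_le, ?_⟩,
    BoseGas.integrable_bose_norm hβ (by linarith), ?_, ?_⟩
  · refine BoseGas.gibbsDefined_of_summable BoseGas.totalNumber_ket ?_ ?_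
    · change Summable (BoseGas.boxWeight ν L 0 0 β (-Δ))
      rw [BoseGas.boxWeight_zero]
      exact (hfree hL).summable_boltzmann
    · change Summable fun n => _ * BoseGas.boxWeight ν L 0 0 β (-Δ) n
      rw [BoseGas.boxWeight_zero]
      exact (hfree hL).summable_mul BoseGas.abs_particles_le
  · refine ((Complex.continuous_ofReal.tendsto _).comp
      (BoseGas.tendsto_tsum_bose (ν := ν) hβ (show -Δ < 0 by linarith))).congr' ?_
    filter_upwards [eventually_gt_atTop 0] with L hL
    have h1 : BoseGas.mean (BoseGas.boxWeight ν L 0 0 β (-Δ)) BoseGas.particles =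
        ∑' m : BoseGas.Mode ν, BoseGas.bose (β * (BoseGas.modeEnergy L m - -Δ)) := by
      rw [BoseGas.boxWeight_zero, (hfree hL).mean_particles,
        (BoseGas.hasSum_bose_referenceEnergy _ hβ (by linarith) hL).tsum_eq]
      ring
    rw [BoseGas.gibbsMean_eq L 0 0 β (-Δ) BoseGas.totalNumber_ket, Function.comp_apply, ← h1,
      Complex.ofReal_div]
    rfl
  · obtain ⟨ρ₀, h₀, hn, hz, hs⟩ := BoseGas.exists_limits hν μ hβ hlam hΔ
    refine ⟨ρ₀, ((Complex.continuous_ofReal.tendsto _).comp h₀).congr fun L => ?_,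
      ((Complex.continuous_ofReal.tendsto _).comp hn).congr fun L => ?_,
      ((Complex.continuous_ofReal.tendsto _).comp hz).congr fun L => ?_,
      ((Complex.continuous_ofReal.tendsto _).comp hs).congr fun L => ?_⟩
    · rw [BoseGas.gibbsMean_eq L 0 lam β μ BoseGas.totalNumber_ket, Function.comp_apply,
        BoseGas.meanDensity, Complex.ofReal_div]
      rfl
    · rw [BoseGas.gibbsMean_eq L Δ lam β μ BoseGas.totalNumber_ket, Function.comp_apply,
        BoseGas.meanDensity, Complex.ofReal_div]
      rfl
    · rw [BoseGas.gibbsMean_eq L Δ lam β μ (b := fun n => (n 0 : ℝ))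
        (fun n => by simp [BoseGas.modeNumber_ket]), Function.comp_apply,
        BoseGas.meanZeroDensity, Complex.ofReal_div]
      rfl
    · rw [BoseGas.gibbsMean_eq L Δ lam β μ BoseGas.totalNumber_sq_ket, Function.comp_apply,
        BoseGas.meanSqDensity, Complex.ofReal_div, Complex.ofReal_pow]
      rfl
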